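/- For $\Re z>0$ put $\theta(z)=\sum_{n\in\mathbf Z}e^{-\pi n^2z}$ and $\psi(z)=\frac{\theta(z)-1}{2}=\sum_{n\ge1}e^{-\pi n^2z}$. Let $\mathcal L(s)$ be the entire function defined by $$\pi^{-s/2}\Gamma(\tfrac s2)\,\mathcal L(s)=-\frac1s+\int_1^\infty x^{s/2}\psi(x)\,\frac{dx}{x},$$ and put $\Lambda(s)=\pi^{-s/2}\Gamma(s/2)\mathcal L(s)$. Theorem. The function $F(s)=s\Lambda(s)=s\pi^{-s/2}\Gamma(s/2)\mathcal L(s)$ (continued to the removable singularities $s=0,-2,-4,\dots$) is an entire function of order $1$. It has exactly one real zero $b_0$, and $|b_0-11.25|<0.005$. It has infinitely many non-real zeros, and they come in complex conjugate pairs: the zeros of $F$, listed with multiplicity, can be numbered as $(b_n)_{n\in\mathbf Z}$ with $b_0$ the real zero, $b_n$ non-real for $n\neq0$, $b_{-n}=\overline{b_n}$, and $|b_n|\le|b_{n+1}|$ for $n\ge1$. The integral $\alpha=\int_1^\infty\psi(y)\,\frac{dy}{y}$ converges absolutely, and for every such numbering and every $s\in\mathbf C$ the product below converges unconditionally and $$F(s)=-e^{-\alpha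 s}\prod_{n\in\mathbf Z}\Bigl(1-\frac{s}{b_n}\Bigr)e^{s/b_n},$$ that is, for $s\ne0$, $$\Lambda(s)=-\frac{e^{-\alpha s}}{s}\prod_{n\in\mathbf Z}\Bigl(1-\frac{s}{b_n}\Bigr)e^{s/b_n}.$$ -/

import Mathlib

open Set MeasureTheory

noncomputable section

/-- The theta function `θ(z) = ∑_{n ∈ ℤ} exp(-π n² z)`, for `Re z > 0`. -/
def thetaFn (z : ℂ) : ℂ := ∑' n : ℤ, Complex.exp (-Real.pi * (n : ℂ) ^ 2 * z)

/-- `ψ(z) = (θ(z) - 1) / 2`, that is `∑_{n ≥ 1} exp(-π n² z)`, for `Re z > 0`. -/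
def psiFn (z : ℂ) : ℂ := (thetaFn z - 1) / 2

/-- The function `𝓛(τ, s)`, defined for `Re τ > 0` and all `s` by
`π^{-s/2} Γ(s/2) 𝓛(τ, s) = -τ^{s/2} / s + τ^{s/2} ∫_1^∞ x^{s/2} ψ(τ x) dx/x`.
To have the right values also at `s = 0, -2, -4, …`, the equation is divided by the Gamma factor
using `s Γ(s/2) = 2 Γ(s/2 + 1)`; Mathlib's `(Complex.Gamma w)⁻¹` is the entire function `1/Γ`. -/
def lavrikL (τ s : ℂ) : ℂ :=
  (Real.pi : ℂ) ^ (s / 2) * τ ^ (s / 2) *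
    (-(2 * Complex.Gamma (s / 2 + 1))⁻¹ +
      (Complex.Gamma (s / 2))⁻¹ * ∫ x in Ioi (1 : ℝ), (x : ℂ) ^ (s / 2) * psiFn (τ * x) / x)

/-- `Λ(s) = π^{-s/2} Γ(s/2) 𝓛(s)` with `𝓛(s) = 𝓛(1, s)`
(meaningful as it stands for `s ≠ 0, -2, -4, …`, the poles of the Gamma factor). -/
def lavrikLambda (s : ℂ) : ℂ :=
  (Real.pi : ℂ) ^ (-s / 2) * Complex.Gamma (s / 2) * lavrikL 1 s

/-- The defining equation of `𝓛(τ, s)`. -/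
theorem lavrikL_equation (τ s : ℂ) (hs : ∀ n : ℕ, s ≠ -2 * (n : ℂ)) :
    (Real.pi : ℂ) ^ (-s / 2) * Complex.Gamma (s / 2) * lavrikL τ s =
      -τ ^ (s / 2) / s +
        τ ^ (s / 2) * ∫ x in Ioi (1 : ℝ), (x : ℂ) ^ (s / 2) * psiFn (τ * x) / x := by
  have h0 : s ≠ 0 := by simpa using hs 0
  have hG : Complex.Gamma (s / 2) ≠ 0 := Complex.Gamma_ne_zero fun m hm => hs m (by
    rw [div_eq_iff two_ne_zero] at hm
    rw [hm]; ring)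
  have hp : (Real.pi : ℂ) ^ (s / 2) ≠ 0 := by
    simp [Complex.cpow_eq_zero_iff, Real.pi_ne_zero]
  rw [lavrikL, Complex.Gamma_add_one _ (div_ne_zero h0 two_ne_zero), neg_div, Complex.cpow_neg]
  field_simp

/-- The order of an entire function: the infimum of all `ρ ≥ 0` such that
`|f(z)| ≤ exp(|z|^ρ)` for all sufficiently large `|z|` (and `∞` if there is none). -/
def entireOrder (f : ℂ → ℂ) : ENNReal :=
  ⨅ (ρ : NNReal)
    (_ : ∀ᶠ z in Bornology.cobounded ℂ, ‖f z‖ ≤ Real.exp (‖z‖ ^ (ρ : ℝ))), (ρ : ENNReal)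

/-- `(b_n)_{n ∈ ℤ}` lists all zeros of `F`, each as often as its multiplicity, with `b_0` real,
`b_n` non-real for `n ≠ 0`, `b_{-n}` the complex conjugate of `b_n`, and `|b_n| ≤ |b_{n+1}|`
for `n ≥ 1`. -/
structure IsZeroNumbering (F : ℂ → ℂ) (b : ℤ → ℂ) : Prop where
  real_zero : (b 0).im = 0
  nonreal : ∀ n : ℤ, n ≠ 0 → (b n).im ≠ 0
  conj : ∀ n : ℤ, b (-n) = (starRingEnd ℂ) (b n)
  monotone : ∀ n : ℤ, 1 ≤ n → ‖b n‖ ≤ ‖b (n + 1)‖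
  multiplicity : ∀ z : ℂ, {n : ℤ | b n = z}.encard = analyticOrderAt F z

/-- `α = ∫_1^∞ ψ(y) dy/y`. -/
def lavrikAlpha : ℂ := ∫ y in Ioi (1 : ℝ), psiFn y / y

end

/-!
The function is `F(s) = -1 + s ∫_1^∞ x^{s/2} ψ(x) dx/x`, and only positivity and exponential decay
of `ψ` matter for most of the argument. Decay gives `|F(s)| ≤ exp(|s|^ρ)` for every `ρ > 1` and
large `|s|`, while on the positive axis `F` outgrows every `exp(Ar)`; hence the order is `1`. For
an entire function of order less than `2`, dividing out the zeros in a disc and applying the maximum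
principle bounds their number, and applying the Borel–Carathéodory theorem to the logarithm of the
quotient gives Hadamard's factorization in genus one, with exponential factor determined by
`F'(0)/F(0) = -α`. Finitely many zeros would make `F` of exponential type, so there are infinitely
many.

On the real axis `r ↦ r ∫_1^∞ x^{r/2} ψ(x) dx/x` is negative for `r < 0` and strictly increasing for
`r ≥ 0`, so `F` has a single real zero, which is simple; the others come in conjugate pairs. To
locate the real zero, `ψ(x)` is compared on `x ≥ 1` with its first term `e^{-πx}`, whose integrals
satisfy the recurrence of the incomplete gamma function.
-/

open Filter Topology Metric Bornology

section ZerosOfEntireFunctions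

variable {ι : Type*} {F g : ℂ → ℂ} {b : ι → ℂ}

theorem analyticOrderAt_ne_top_of_apply_ne_zero (hF : Differentiable ℂ F) {a : ℂ} (ha : F a ≠ 0)
    (z : ℂ) : analyticOrderAt F z ≠ ⊤ :=
  AnalyticOnNhd.analyticOrderAt_ne_top_of_isPreconnected (fun w _ => hF.analyticAt w)
    isPreconnected_univ (mem_univ a) (mem_univ z)
    (by simp [(hF.analyticAt a).analyticOrderAt_eq_zero.mpr ha])

theorem finite_zeros_inter_closedBall (hF : Differentiable ℂ F) {a : ℂ} (ha : F a ≠ 0) (R : ℝ) :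
    (closedBall 0 R ∩ F ⁻¹' {0}).Finite := by
  have h := mem_codiscrete'.mp
    (AnalyticOnNhd.preimage_zero_mem_codiscrete (fun w _ => hF.analyticAt w) ha)
  rw [preimage_compl, isOpen_compl_iff, compl_compl] at h
  exact ((isCompact_closedBall 0 R).inter_right h.1).finite (h.2.mono inter_subset_right)

theorem apply_eq_zero_of_encard_le (hb : ∀ z, {i | b i = z}.encard ≤ analyticOrderAt F z) (i : ι) :
    F (b i) = 0 :=
  apply_eq_zero_of_analyticOrderAt_ne_zero <|
    ((Set.encard_pos.mpr ⟨i, mem_ofPred_eq ▸ rfl⟩).trans_le (hb (b i))).ne'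

theorem finite_norm_le_of_encard_le (hF : Differentiable ℂ F) {a : ℂ} (ha : F a ≠ 0)
    (hb : ∀ z, {i | b i = z}.encard ≤ analyticOrderAt F z) (R : ℝ) : {i | ‖b i‖ ≤ R}.Finite := by
  refine ((finite_zeros_inter_closedBall hF ha R).preimage' (f := b) fun z _ => ?_).subset
    fun i hi => ⟨by simpa using hi, apply_eq_zero_of_encard_le hb i⟩
  exact Set.encard_lt_top_iff.mp
    ((hb z).trans_lt (analyticOrderAt_ne_top_of_apply_ne_zero hF ha z).lt_top)

theorem hasDerivAt_one_sub_div (a z : ℂ) : HasDerivAt (fun z => 1 - z / a) (-(1 / a)) z := by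
  simpa using ((hasDerivAt_id z).div_const a).const_sub 1

theorem analyticOrderAt_one_sub_div {a : ℂ} (ha : a ≠ 0) (z : ℂ) :
    analyticOrderAt (fun z => 1 - z / a) z = if a = z then 1 else 0 := by
  have hlin : AnalyticAt ℂ (fun z => 1 - z / a) z := by fun_prop
  split_ifs with hz
  · subst hz
    exact hlin.analyticOrderAt_eq_one_of_zero_deriv_ne_zero (by simp [ha])
      (by simpa [(hasDerivAt_one_sub_div a a).deriv] using ha)
  · refine hlin.analyticOrderAt_eq_zero.mpr fun h0 => hz ?_
    rw [sub_eq_zero, eq_comm, div_eq_one_iff_eq ha] at h0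
    exact h0.symm

theorem exists_eq_one_sub_div_mul (hg : Differentiable ℂ g) {a : ℂ} (ha : a ≠ 0) (hga : g a = 0) :
    ∃ q : ℂ → ℂ, Differentiable ℂ q ∧ ∀ z, g z = (1 - z / a) * q z := by
  have hslope : Differentiable ℂ (dslope g a) := by
    rw [← differentiableOn_univ] at hg ⊢
    exact (Complex.differentiableOn_dslope univ_mem).mpr hg
  refine ⟨fun z => -a * dslope g a z, hslope.const_mul _, fun z => ?_⟩
  have h := sub_smul_dslope g a z
  rw [hga, sub_zero, smul_eq_mul] at h
  rw [← h]
  field_simp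
  ring

theorem encard_mem_cons_and_eq {S : Finset ι} {j : ι} (hj : j ∉ S) (z : ℂ) :
    {i | i ∈ S.cons j hj ∧ b i = z}.encard =
      {i | i ∈ S ∧ b i = z}.encard + if b j = z then 1 else 0 := by
  split_ifs with hz
  · rw [← Set.encard_insert_of_notMem (a := j) (by simp [hj])]
    congr 1
    ext i
    simp only [Finset.mem_cons, mem_ofPred_eq, mem_insert_iff, or_and_right]
    exact or_congr_left (and_iff_left_of_imp (· ▸ hz))
  · rw [add_zero]
    congr 1
    ext i
    simp only [Finset.mem_cons, mem_ofPred_eq, or_and_right]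
    exact or_iff_right fun hi => hz (hi.1 ▸ hi.2)

theorem exists_eq_prod_mul_of_encard_le (hF : Differentiable ℂ F) (S : Finset ι)
    (hb : ∀ i ∈ S, b i ≠ 0) (hS : ∀ z, {i | i ∈ S ∧ b i = z}.encard ≤ analyticOrderAt F z) :
    ∃ g : ℂ → ℂ, Differentiable ℂ g ∧ (∀ z, F z = (∏ i ∈ S, (1 - z / b i)) * g z) ∧
      ∀ z, analyticOrderAt F z = {i | i ∈ S ∧ b i = z}.encard + analyticOrderAt g z := by
  induction S using Finset.cons_induction with
  | empty => exact ⟨F, hF, by simp, by simp⟩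
  | cons j S hj ih =>
    simp only [encard_mem_cons_and_eq] at hS ⊢
    obtain ⟨g, hg, hFg, hord⟩ := ih (fun i hi => hb i (Finset.mem_cons_of_mem hi))
      fun z => le_self_add.trans (hS z)
    have hbj : b j ≠ 0 := hb j (Finset.mem_cons_self j S)
    have hgj : g (b j) = 0 := by
      have hfin : {i | i ∈ S ∧ b i = b j}.encard ≠ ⊤ :=
        Set.encard_ne_top_iff.mpr (S.finite_toSet.subset fun i hi => hi.1)
      have h := hS (b j)
      rw [hord, if_pos rfl, ENat.add_le_add_iff_left hfin] at h
      exact apply_eq_zero_of_analyticOrderAt_ne_zero (zero_lt_one.trans_le h).ne'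
    obtain ⟨q, hq, hgq⟩ := exists_eq_one_sub_div_mul hg hbj hgj
    refine ⟨q, hq, fun z => ?_, fun z => ?_⟩
    · rw [hFg, Finset.prod_cons, hgq]
      ring
    · rw [hord, add_assoc, ← analyticOrderAt_one_sub_div hbj,
        ← analyticOrderAt_mul (by fun_prop) (hq.analyticAt z)]
      exact congrArg (_ + analyticOrderAt · z) (funext hgq)

theorem norm_le_of_forall_sphere_norm_le (hg : Differentiable ℂ g) {R C : ℝ}
    (hR : 0 < R) (h : ∀ z, ‖z‖ = R → ‖g z‖ ≤ C) {z : ℂ} (hz : ‖z‖ ≤ R) : ‖g z‖ ≤ C := by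
  refine Complex.norm_le_of_forall_mem_frontier_norm_le (U := ball 0 R) isBounded_ball
    hg.diffContOnCl (fun w hw => h w ?_) ?_
  · simpa [frontier_ball _ hR.ne'] using hw
  · simpa [closure_ball _ hR.ne'] using hz

theorem pow_card_le_norm_prod_one_sub_div {S : Finset ι} {k R : ℝ} (hk : 0 ≤ k)
    (hb : ∀ i ∈ S, b i ≠ 0) (hS : ∀ i ∈ S, ‖b i‖ ≤ R) {z : ℂ} (hz : ‖z‖ = (k + 1) * R) :
    k ^ S.card ≤ ‖∏ i ∈ S, (1 - z / b i)‖ := by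
  rw [norm_prod, ← Finset.prod_const]
  refine Finset.prod_le_prod (fun _ _ => hk) fun i hi => ?_
  have hdiv : k + 1 ≤ ‖z / b i‖ := by
    rw [norm_div, le_div_iff₀ (norm_pos_iff.mpr (hb i hi)), hz]
    exact mul_le_mul_of_nonneg_left (hS i hi) (by positivity)
  have htri := norm_sub_norm_le (z / b i) 1
  rw [norm_one, norm_sub_rev] at htri
  linarith

theorem pow_card_mul_norm_cofactor_le (hg : Differentiable ℂ g) {S : Finset ι}
    (hFg : ∀ z, F z = (∏ i ∈ S, (1 - z / b i)) * g z) {k R M : ℝ} (hk : 0 < k) (hR : 0 < R)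
    (hb : ∀ i ∈ S, b i ≠ 0) (hS : ∀ i ∈ S, ‖b i‖ ≤ R)
    (hM : ∀ z, ‖z‖ = (k + 1) * R → ‖F z‖ ≤ M) {z : ℂ} (hz : ‖z‖ ≤ (k + 1) * R) :
    k ^ S.card * ‖g z‖ ≤ M := by
  rw [← le_div_iff₀' (by positivity)]
  refine norm_le_of_forall_sphere_norm_le hg (by positivity) (fun w hw => ?_) hz
  rw [le_div_iff₀' (by positivity)]
  calc k ^ S.card * ‖g w‖ ≤ ‖∏ i ∈ S, (1 - w / b i)‖ * ‖g w‖ := by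
        gcongr
        exact pow_card_le_norm_prod_one_sub_div hk.le hb hS hw
    _ = ‖F w‖ := by rw [hFg, norm_mul]
    _ ≤ M := hM w hw

/-- `b` lists all zeros of `F`, each as often as its multiplicity, in no particular order and over
an arbitrary index type. -/
def ListsZeros (F : ℂ → ℂ) (b : ι → ℂ) : Prop :=
  ∀ z, {i | b i = z}.encard = analyticOrderAt F z

namespace ListsZeros

theorem apply_ne_zero (h : ListsZeros F b) (h0 : F 0 ≠ 0) (i : ι) : b i ≠ 0 := fun hi =>
  h0 (hi ▸ apply_eq_zero_of_encard_le (fun z => (h z).le) i)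

theorem finite_norm_le (h : ListsZeros F b) (hF : Differentiable ℂ F) (h0 : F 0 ≠ 0) (R : ℝ) :
    {i | ‖b i‖ ≤ R}.Finite :=
  finite_norm_le_of_encard_le hF h0 (fun z => (h z).le) R

theorem exists_eq_prod_mul (h : ListsZeros F b) (hF : Differentiable ℂ F) (h0 : F 0 ≠ 0)
    (S : Finset ι) :
    ∃ g : ℂ → ℂ, Differentiable ℂ g ∧ (∀ z, F z = (∏ i ∈ S, (1 - z / b i)) * g z) ∧
      ∀ z, (∀ i, b i = z → i ∈ S) → g z ≠ 0 := by
  obtain ⟨g, hg, hFg, hord⟩ := exists_eq_prod_mul_of_encard_le hF S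
    (fun i _ => h.apply_ne_zero h0 i) fun z => by
      rw [← h z]
      exact Set.encard_le_encard fun i hi => hi.2
  refine ⟨g, hg, hFg, fun z hz => ?_⟩
  have hall : {i | i ∈ S ∧ b i = z} = {i | b i = z} := by
    ext i
    simpa using hz i
  have hcancel : analyticOrderAt F z + analyticOrderAt g z ≤ analyticOrderAt F z + 0 := by
    simpa only [hall, h z, add_zero] using (hord z).ge
  rw [ENat.add_le_add_iff_left (analyticOrderAt_ne_top_of_apply_ne_zero hF h0 z),
    nonpos_iff_eq_zero] at hcancel
  exact (hg.analyticAt z).analyticOrderAt_eq_zero.mp hcancel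

theorem two_pow_card_mul_norm_le (h : ListsZeros F b) (hF : Differentiable ℂ F) (h0 : F 0 ≠ 0)
    {S : Finset ι} {R M : ℝ} (hR : 0 < R) (hS : ∀ i ∈ S, ‖b i‖ ≤ R)
    (hM : ∀ z, ‖z‖ = 3 * R → ‖F z‖ ≤ M) : 2 ^ S.card * ‖F 0‖ ≤ M := by
  obtain ⟨g, hg, hFg, -⟩ := h.exists_eq_prod_mul hF h0 S
  rw [show F 0 = g 0 by simpa using hFg 0]
  refine pow_card_mul_norm_cofactor_le hg hFg two_pos hR (fun i _ => h.apply_ne_zero h0 i) hS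
    (fun z hz => hM z (by linarith)) ?_
  rw [norm_zero]
  positivity

end ListsZeros

end ZerosOfEntireFunctions

section Enumeration

theorem nonempty_nat_orderIso_of_finite_Iic {α : Type*} [LinearOrder α] [Infinite α]
    (h : ∀ a : α, (Iic a).Finite) : Nonempty (ℕ ≃o α) := by
  have hrank : StrictMono fun a : α => (Iio a).ncard := fun a b hab =>
    ncard_lt_ncard ⟨Iio_subset_Iio hab.le, fun hsub => lt_irrefl a (hsub hab)⟩
      ((h b).subset Iio_subset_Iic_self)
  have : Infinite (range fun a : α => (Iio a).ncard) :=
    (infinite_range_of_injective hrank.injective).to_subtype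
  classical
  exact ⟨(Nat.Subtype.orderIsoOfNat _).trans hrank.orderIso.symm⟩

theorem exists_equiv_nat_monotone {T : Type*} [Infinite T] (f : T → ℝ)
    (hf : ∀ R, {t | f t ≤ R}.Finite) : ∃ e : ℕ ≃ T, Monotone (f ∘ e) := by
  have : Countable T := countable_univ_iff.mp <|
    (countable_iUnion fun n : ℕ => (hf n).countable).mono fun t _ =>
      mem_iUnion.mpr (exists_nat_ge (f t))
  obtain ⟨c, hc⟩ := exists_injective_nat T
  let key (t : T) : ℝ ×ₗ ℕ := toLex (f t, c t)
  let : LinearOrder T := LinearOrder.lift' key fun s t hst =>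
    hc (congrArg (fun p => (ofLex p).2) hst)
  have hmono {s t : T} (hst : s ≤ t) : f s ≤ f t := by
    rcases Prod.Lex.toLex_le_toLex.mp (show key s ≤ key t from hst) with h | h
    · exact h.le
    · exact h.1.le
  obtain ⟨e⟩ := nonempty_nat_orderIso_of_finite_Iic fun t : T => (hf (f t)).subset fun _ => hmono
  exact ⟨e.toEquiv, fun m n hmn => hmono (e.monotone hmn)⟩

end Enumeration

section HadamardFactorization

variable {ι : Type*} {F g : ℂ → ℂ} {b : ι → ℂ}

theorem exists_norm_le_mul_exp_rpow_of_entireOrder_lt {σ : NNReal} (hσ : entireOrder F < σ)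
    {C : ℝ} (hC : 0 < C) :
    ∃ ρ : ℝ, 0 < ρ ∧ ρ < σ ∧ ∃ r : ℝ, ∀ z, r ≤ ‖z‖ → ‖F z‖ ≤ C * Real.exp (‖z‖ ^ ρ) := by
  obtain ⟨ρ₀, hρ₀⟩ := iInf_lt_iff.mp hσ
  obtain ⟨hgrow, hρ₀σ⟩ := iInf_lt_iff.mp hρ₀
  obtain ⟨ρ, hρ₀ρ, hρσ⟩ := exists_between (NNReal.coe_lt_coe.mpr (ENNReal.coe_lt_coe.mp hρ₀σ))
  obtain ⟨r₁, -, hr₁⟩ := hasBasis_cobounded_norm.eventually_iff.mp hgrow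
  obtain ⟨r₂, hr₂⟩ := eventually_atTop.mp <|
    (tendsto_rpow_atTop (sub_pos.mpr hρ₀ρ)).eventually_ge_atTop (1 + |Real.log C|)
  refine ⟨ρ, ρ₀.coe_nonneg.trans_lt hρ₀ρ, hρσ, max 1 (max r₁ r₂), fun z hz => ?_⟩
  simp only [max_le_iff] at hz
  have hpow : ‖z‖ ^ (ρ₀ : ℝ) + |Real.log C| ≤ ‖z‖ ^ ρ := by
    calc ‖z‖ ^ (ρ₀ : ℝ) + |Real.log C| ≤ ‖z‖ ^ (ρ₀ : ℝ) * (1 + |Real.log C|) := by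
          nlinarith [Real.one_le_rpow hz.1 ρ₀.coe_nonneg, abs_nonneg (Real.log C)]
      _ ≤ ‖z‖ ^ (ρ₀ : ℝ) * ‖z‖ ^ (ρ - ρ₀) := by gcongr; exact hr₂ _ hz.2.2
      _ = ‖z‖ ^ ρ := by rw [← Real.rpow_add (by linarith), add_sub_cancel]
  calc ‖F z‖ ≤ Real.exp (‖z‖ ^ (ρ₀ : ℝ)) := hr₁ hz.2.1
    _ ≤ Real.exp (Real.log C + ‖z‖ ^ ρ) := by
        gcongr
        linarith [neg_abs_le (Real.log C)]
    _ = C * Real.exp (‖z‖ ^ ρ) := by rw [Real.exp_add, Real.exp_log hC]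

theorem ListsZeros.exists_card_le_rpow (h : ListsZeros F b) (hF : Differentiable ℂ F)
    (h0 : F 0 ≠ 0) {σ : NNReal} (hσ : entireOrder F < σ) :
    ∃ ρ : ℝ, 0 < ρ ∧ ρ < σ ∧ ∃ r : ℝ, ∀ R, r ≤ R → ∀ S : Finset ι, (∀ i ∈ S, ‖b i‖ ≤ R) →
      (S.card : ℝ) ≤ 2 * (3 * R) ^ ρ := by
  have hF0 : 0 < ‖F 0‖ := norm_pos_iff.mpr h0
  obtain ⟨ρ, hρ, hρσ, r, hr⟩ := exists_norm_le_mul_exp_rpow_of_entireOrder_lt hσ hF0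
  refine ⟨ρ, hρ, hρσ, max r 1, fun R hR S hS => ?_⟩
  have hR1 : 1 ≤ R := (le_max_right _ _).trans hR
  have hjensen := h.two_pow_card_mul_norm_le hF h0 (M := ‖F 0‖ * Real.exp ((3 * R) ^ ρ))
    (zero_lt_one.trans_le hR1) hS fun z hz =>
      hz ▸ hr z (by linarith [le_max_left r 1])
  rw [mul_comm, mul_le_mul_iff_right₀ hF0] at hjensen
  have hlog := Real.log_le_log (by positivity) hjensen
  rw [Real.log_pow, Real.log_exp] at hlog
  nlinarith [Real.log_two_gt_d9, (Nat.cast_nonneg S.card : (0 : ℝ) ≤ S.card)]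

theorem ListsZeros.summable_norm_rpow_inv (h : ListsZeros F b) (hF : Differentiable ℂ F)
    (h0 : F 0 ≠ 0) {σ : NNReal} (hσ : entireOrder F < σ) :
    Summable fun i => (‖b i‖ ^ (σ : ℝ))⁻¹ := by
  cases finite_or_infinite ι
  · exact Summable.of_finite
  obtain ⟨e, he⟩ := exists_equiv_nat_monotone (fun i => ‖b i‖) (h.finite_norm_le hF h0)
  obtain ⟨ρ, hρ, hρσ, r, hr⟩ := h.exists_card_le_rpow hF h0 hσ
  have hlarge : ∀ᶠ n in cofinite, r ≤ ‖b (e n)‖ := by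
    filter_upwards [e.injective.tendsto_cofinite.eventually
      (h.finite_norm_le hF h0 r).eventually_cofinite_notMem] with n hn
    exact (not_le.mp hn).le
  have hbound : ∀ᶠ n in cofinite, ‖(‖b (e n)‖ ^ (σ : ℝ))⁻¹‖ ≤
      3 ^ (σ : ℝ) * 2 ^ (σ / ρ) * (1 / (n : ℝ) ^ (σ / ρ)) := by
    filter_upwards [hlarge, (finite_singleton 0).eventually_cofinite_notMem] with n hn hn0
    have hn0' : (0 : ℝ) < n := Nat.cast_pos.mpr (Nat.pos_of_ne_zero hn0)
    have hb0 : 0 < ‖b (e n)‖ := norm_pos_iff.mpr (h.apply_ne_zero h0 _)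
    have hcard := hr _ hn ((Finset.range n).map e.toEmbedding) fun i hi => by
      obtain ⟨m, hm, rfl⟩ := Finset.mem_map.mp hi
      exact he (Finset.mem_range.mp hm).le
    rw [Finset.card_map, Finset.card_range] at hcard
    have hpow : (n / 2 : ℝ) ^ (σ / ρ) ≤ (3 * ‖b (e n)‖) ^ (σ : ℝ) := by
      calc (n / 2 : ℝ) ^ (σ / ρ) ≤ ((3 * ‖b (e n)‖) ^ ρ) ^ (σ / ρ) := by gcongr; linarith
        _ = (3 * ‖b (e n)‖) ^ (σ : ℝ) := by
          rw [← Real.rpow_mul (by positivity), mul_div_cancel₀ _ hρ.ne']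
    rw [Real.div_rpow hn0'.le two_pos.le, Real.mul_rpow three_pos.le hb0.le,
      div_le_iff₀ (by positivity)] at hpow
    rw [Real.norm_of_nonneg (by positivity), mul_one_div, le_div_iff₀ (by positivity),
      inv_mul_le_iff₀ (by positivity)]
    linarith
  refine e.summable_iff.mp (Summable.of_norm_bounded_eventually ?_ hbound)
  exact (Real.summable_one_div_nat_rpow.mpr ((one_lt_div hρ).mpr hρσ)).mul_left _

theorem tendsto_mul_rpow_div_sq_atTop {ρ k : ℝ} (hρ : ρ < 2) (hk : 0 ≤ k) (C : ℝ) :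
    Tendsto (fun x : ℝ => C * (k * x) ^ ρ / x ^ 2) atTop (𝓝 0) := by
  have hpow := (tendsto_rpow_neg_atTop (sub_pos.mpr hρ)).const_mul (C * k ^ ρ)
  refine (mul_zero (C * k ^ ρ) ▸ hpow).congr' ?_
  filter_upwards [eventually_gt_atTop 0] with x hx
  rw [neg_sub, Real.rpow_sub hx, Real.mul_rpow hk hx.le, Real.rpow_two]
  ring

theorem exists_log_on_ball {c : ℂ} {R : ℝ} (hR : 0 < R) (hg : DifferentiableOn ℂ g (ball c R))
    (hne : ∀ z ∈ ball c R, g z ≠ 0) :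
    ∃ h : ℂ → ℂ, h c = 0 ∧ DifferentiableOn ℂ h (ball c R) ∧ deriv h c = logDeriv g c ∧
      ∀ z ∈ ball c R, g z = g c * Complex.exp (h z) := by
  have hc : c ∈ ball c R := mem_ball_self hR
  obtain ⟨h, hhc, hh⟩ := ((hg.deriv isOpen_ball).div hg hne).isExactOn_ball.with_val_at c 0
  have hconst : ∀ w ∈ ball c R, HasDerivAt (fun w => g w * Complex.exp (-h w)) 0 w := fun w hw => by
    have hgw := (hg.differentiableAt (isOpen_ball.mem_nhds hw)).hasDerivAt
    refine (hgw.mul (hh w hw).fun_neg.cexp).congr_deriv ?_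
    rw [Pi.div_apply]
    field_simp [hne w hw]
    ring
  refine ⟨h, hhc, fun z hz => (hh z hz).differentiableAt.differentiableWithinAt,
    (hh c hc).deriv, fun z hz => ?_⟩
  have heq := isOpen_ball.is_const_of_deriv_eq_zero (convex_ball c R).isPreconnected
    (fun w hw => (hconst w hw).differentiableAt.differentiableWithinAt)
    (fun w hw => (hconst w hw).deriv) hz hc
  simp only [hhc, neg_zero, Complex.exp_zero, mul_one] at heq
  rw [← heq, mul_assoc, ← Complex.exp_add, neg_add_cancel, Complex.exp_zero, mul_one]

theorem norm_sub_deriv_mul_le_of_re_le {h : ℂ → ℂ} {R M : ℝ} (hR : 0 < R) (hM : 0 < M)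
    (hd : DifferentiableOn ℂ h (ball 0 R)) (h0 : h 0 = 0)
    (hre : ∀ z ∈ ball (0 : ℂ) R, (h z).re ≤ M) {z : ℂ} (hz : ‖z‖ < R / 2) :
    ‖h z - deriv h 0 * z‖ ≤ 16 * ‖z‖ ^ 2 * M / R ^ 2 := by
  have hsub : ball (0 : ℂ) (R / 2) ⊆ ball 0 R := ball_subset_ball (by linarith)
  have hd' := hd.mono hsub
  have hnorm : ∀ w ∈ ball (0 : ℂ) (R / 2), ‖h w‖ ≤ 2 * M := fun w hw => by
    refine (Complex.borelCaratheodory_zero hM hd hre hR (hsub hw) h0).trans ?_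
    rw [mem_ball_zero_iff] at hw
    rw [div_le_iff₀ (by linarith)]
    nlinarith
  have hderiv : ‖deriv h 0‖ ≤ 2 * M / (R / 2) :=
    Complex.norm_deriv_le_div_of_mapsTo_ball hd'
      (fun w hw => by simpa [h0] using hnorm w hw) (by positivity)
  have hremainder : ∀ w ∈ ball (0 : ℂ) (R / 2), ‖h w - deriv h 0 * w‖ ≤ 4 * M := fun w hw => by
    calc ‖h w - deriv h 0 * w‖ ≤ ‖h w‖ + ‖deriv h 0‖ * ‖w‖ := by
          rw [← norm_mul]; exact norm_sub_le _ _
      _ ≤ 2 * M + 2 * M / (R / 2) * (R / 2) := by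
          gcongr
          · exact hnorm w hw
          · exact (mem_ball_zero_iff.mp hw).le
      _ = 4 * M := by field_simp; ring
  have hlittleO : (fun w => h w - deriv h 0 * w) =o[𝓝 0] fun w => ‖w‖ := by
    simpa [h0, mul_comm] using
      (hd.differentiableAt (ball_mem_nhds _ hR)).hasDerivAt.isLittleO.norm_right
  have hschwarz := Complex.dist_le_mul_div_pow_of_mapsTo_ball_of_isLittleO
    (f := fun w => h w - deriv h 0 * w) (c := 0) (z := z) (R₁ := R / 2) (R₂ := 4 * M) (n := 1)
    (hd'.sub (by fun_prop)) (fun w hw => by simpa [h0] using hremainder w hw)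
    (by simpa [h0] using hlittleO) (by simpa using hz)
  simp only [dist_eq_norm, h0, mul_zero, sub_zero] at hschwarz
  refine hschwarz.trans_eq ?_
  rw [div_pow, div_pow]
  field_simp
  ring

theorem norm_one_sub_mul_exp_sub_one_le {w : ℂ} (hw : ‖w‖ ≤ 1) :
    ‖(1 - w) * Complex.exp w - 1‖ ≤ 3 * ‖w‖ ^ 2 := by
  calc ‖(1 - w) * Complex.exp w - 1‖
      = ‖(1 - w) * (Complex.exp w - 1 - w) - w ^ 2‖ := by congr 1; ring
    _ ≤ (1 + ‖w‖) * ‖w‖ ^ 2 + ‖w‖ ^ 2 := by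
        refine (norm_sub_le _ _).trans ?_
        rw [norm_mul, norm_pow]
        gcongr
        · exact (norm_sub_le _ _).trans_eq (by rw [norm_one])
        · exact Complex.norm_exp_sub_one_sub_id_le hw
    _ ≤ 3 * ‖w‖ ^ 2 := by nlinarith [sq_nonneg ‖w‖]

theorem norm_one_sub_mul_exp_le (w : ℂ) : ‖(1 - w) * Complex.exp w‖ ≤ Real.exp (2 * ‖w‖) := by
  calc ‖(1 - w) * Complex.exp w‖ ≤ (1 + ‖w‖) * Real.exp ‖w‖ := by
        rw [norm_mul]
        gcongr
        · exact (norm_sub_le _ _).trans_eq (by rw [norm_one])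
        · exact Complex.norm_exp_le_exp_norm w
    _ ≤ Real.exp ‖w‖ * Real.exp ‖w‖ := by gcongr; linarith [Real.add_one_le_exp ‖w‖]
    _ = Real.exp (2 * ‖w‖) := by rw [← Real.exp_add, two_mul]

theorem multipliable_one_sub_div_mul_exp (hsum : Summable fun i => (‖b i‖ ^ 2)⁻¹) (s : ℂ) :
    Multipliable fun i => (1 - s / b i) * Complex.exp (s / b i) := by
  have hdiv : Summable fun i => ‖s / b i‖ ^ 2 :=
    (hsum.mul_left (‖s‖ ^ 2)).congr fun i => by rw [norm_div, div_pow, div_eq_mul_inv]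
  have hfactor : Summable fun i => ‖(1 - s / b i) * Complex.exp (s / b i) - 1‖ := by
    refine Summable.of_norm_bounded_eventually (hdiv.mul_left 3) ?_
    filter_upwards [hdiv.tendsto_cofinite_zero.eventually_le_const one_pos] with i hi
    rw [norm_norm]
    exact norm_one_sub_mul_exp_sub_one_le ((sq_le_one_iff₀ (norm_nonneg _)).mp hi)
  simpa using multipliable_one_add_of_summable hfactor

theorem logDeriv_prod_one_sub_div_mul (S : Finset ι) (hg : DifferentiableAt ℂ g 0)
    (hg0 : g 0 ≠ 0) :
    logDeriv (fun z => (∏ i ∈ S, (1 - z / b i)) * g z) 0 =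
      logDeriv g 0 - ∑ i ∈ S, 1 / b i := by
  have hlin (i : ι) : logDeriv (fun z => 1 - z / b i) 0 = -(1 / b i) := by
    simp [logDeriv_apply, (hasDerivAt_one_sub_div (b i) 0).deriv]
  rw [logDeriv_mul 0 (by simp) hg0 (by fun_prop) hg, logDeriv_prod (by simp) (by fun_prop)]
  simp only [hlin, Finset.sum_neg_distrib]
  ring

namespace ListsZeros

theorem exists_eq_prod_mul_exp (h : ListsZeros F b) (hF : Differentiable ℂ F) (h0 : F 0 ≠ 0)
    {S : Finset ι} {R M : ℝ} (hR : 0 < R) (hM : 0 < M) (hS : ∀ i, i ∈ S ↔ ‖b i‖ ≤ R)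
    (hbound : ∀ z, ‖z‖ = 2 * R → ‖F z‖ ≤ ‖F 0‖ * Real.exp M) {z : ℂ} (hz : ‖z‖ < R / 2) :
    ∃ E : ℂ, ‖E‖ ≤ 16 * ‖z‖ ^ 2 * M / R ^ 2 ∧
      F z = F 0 * Complex.exp (logDeriv F 0 * z) *
        (∏ i ∈ S, (1 - z / b i) * Complex.exp (z / b i)) * Complex.exp E := by
  obtain ⟨g, hg, hFg, hne⟩ := h.exists_eq_prod_mul hF h0 S
  have hg0 : g 0 = F 0 := by simpa using (hFg 0).symm
  have hgne : ∀ w ∈ ball (0 : ℂ) R, g w ≠ 0 := fun w hw => hne w fun i hi =>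
    (hS i).mpr (hi ▸ (mem_ball_zero_iff.mp hw).le)
  have hgle : ∀ w ∈ ball (0 : ℂ) R, ‖g w‖ ≤ ‖F 0‖ * Real.exp M := fun w hw => by
    simpa using pow_card_mul_norm_cofactor_le hg hFg one_pos hR (fun i _ => h.apply_ne_zero h0 i)
      (fun i hi => (hS i).mp hi) (fun u hu => hbound u (by linarith))
      (show ‖w‖ ≤ (1 + 1) * R by linarith [mem_ball_zero_iff.mp hw])
  obtain ⟨k, hk0, hkd, hkderiv, hk⟩ := exists_log_on_ball hR hg.differentiableOn hgne
  refine ⟨k z - deriv k 0 * z, norm_sub_deriv_mul_le_of_re_le hR hM hkd hk0 (fun w hw => ?_) hz, ?_⟩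
  · have hw' := hgle w hw
    rw [hk w hw, norm_mul, hg0, Complex.norm_exp,
      mul_le_mul_iff_right₀ (norm_pos_iff.mpr h0)] at hw'
    exact Real.exp_le_exp.mp hw'
  · have hlog : logDeriv F 0 = deriv k 0 - ∑ i ∈ S, 1 / b i := by
      rw [hkderiv, ← logDeriv_prod_one_sub_div_mul S (hg 0) (hg0 ▸ h0)]
      exact congrArg (logDeriv · 0) (funext hFg)
    have hexp : Complex.exp (k z) = Complex.exp (logDeriv F 0 * z) *
        Complex.exp (∑ i ∈ S, z / b i) * Complex.exp (k z - deriv k 0 * z) := by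
      rw [← Complex.exp_add, ← Complex.exp_add, hlog]
      simp only [div_eq_mul_inv, ← Finset.mul_sum, one_mul]
      ring_nf
    rw [hFg z, hk z (mem_ball_zero_iff.mpr (by linarith [norm_nonneg z])), hg0, hexp,
      Finset.prod_mul_distrib, ← Complex.exp_sum]
    ring

theorem tendsto_prod_norm_le (h : ListsZeros F b) (hF : Differentiable ℂ F) (h0 : F 0 ≠ 0)
    (hσ : entireOrder F < 2) (z : ℂ) :
    Tendsto (fun n : ℕ => ∏ i ∈ (h.finite_norm_le hF h0 n).toFinset,
      (1 - z / b i) * Complex.exp (z / b i)) atTop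
      (𝓝 (F z / (F 0 * Complex.exp (logDeriv F 0 * z)))) := by
  obtain ⟨ρ, -, hρ2, r, hr⟩ :=
    exists_norm_le_mul_exp_rpow_of_entireOrder_lt (σ := 2) hσ (norm_pos_iff.mpr h0)
  have hfactor : ∀ᶠ n : ℕ in atTop, ∃ E : ℂ,
      ‖E‖ ≤ 16 * ‖z‖ ^ 2 * (2 * n : ℝ) ^ ρ / (n : ℝ) ^ 2 ∧
      F z = F 0 * Complex.exp (logDeriv F 0 * z) *
        (∏ i ∈ (h.finite_norm_le hF h0 n).toFinset, (1 - z / b i) * Complex.exp (z / b i)) *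
          Complex.exp E := by
    filter_upwards [tendsto_natCast_atTop_atTop.eventually_gt_atTop r,
      tendsto_natCast_atTop_atTop.eventually_gt_atTop (2 * ‖z‖)] with n hrn hzn
    have hn : (0 : ℝ) < n := lt_of_le_of_lt (by positivity) hzn
    exact h.exists_eq_prod_mul_exp hF h0 hn (by positivity) (by simp)
      (fun w hw => hw ▸ hr w (by linarith)) (by linarith)
  obtain ⟨N, hN⟩ := eventually_atTop.mp hfactor
  choose! E hEnorm hE using hN
  have hE0 : Tendsto E atTop (𝓝 0) :=
    squeeze_zero_norm' (eventually_atTop.mpr ⟨N, hEnorm⟩) <|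
      (tendsto_mul_rpow_div_sq_atTop hρ2 two_pos.le _).comp tendsto_natCast_atTop_atTop
  have hlim := ((Complex.continuous_exp.tendsto _).comp hE0.neg).const_mul
    (F z / (F 0 * Complex.exp (logDeriv F 0 * z)))
  rw [neg_zero, Complex.exp_zero, mul_one] at hlim
  refine hlim.congr' (eventually_atTop.mpr ⟨N, fun n hn => ?_⟩)
  rw [Function.comp_apply, Complex.exp_neg, ← div_eq_mul_inv,
    div_eq_iff (Complex.exp_ne_zero _), div_eq_iff (by simp [h0]), hE n hn]
  ring

theorem hasProd_one_sub_div_mul_exp (h : ListsZeros F b) (hF : Differentiable ℂ F) (h0 : F 0 ≠ 0)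
    (hσ : entireOrder F < 2) (s : ℂ) :
    HasProd (fun i => (1 - s / b i) * Complex.exp (s / b i))
      (F s / (F 0 * Complex.exp (logDeriv F 0 * s))) := by
  have hsum : Summable fun i => (‖b i‖ ^ 2)⁻¹ := by
    simpa using h.summable_norm_rpow_inv hF h0 (σ := 2) hσ
  have hdiscs : Tendsto (fun n : ℕ => (h.finite_norm_le hF h0 n).toFinset) atTop atTop := by
    refine tendsto_atTop_finset_of_monotone (fun m n hmn i hi => ?_) fun i => ?_
    · rw [Finite.mem_toFinset, mem_ofPred_eq] at hi ⊢
      exact hi.trans (Nat.cast_le.mpr hmn)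
    · simpa using exists_nat_ge ‖b i‖
  have hprod := (multipliable_one_sub_div_mul_exp hsum s).hasProd
  rwa [tendsto_nhds_unique (hprod.comp hdiscs) (h.tendsto_prod_norm_le hF h0 hσ s)] at hprod

theorem eq_mul_tprod (h : ListsZeros F b) (hF : Differentiable ℂ F) (h0 : F 0 ≠ 0)
    (hσ : entireOrder F < 2) (s : ℂ) :
    F s = F 0 * Complex.exp (logDeriv F 0 * s) *
      ∏' i, (1 - s / b i) * Complex.exp (s / b i) := by
  rw [(h.hasProd_one_sub_div_mul_exp hF h0 hσ s).tprod_eq,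
    mul_div_cancel₀ _ (mul_ne_zero h0 (Complex.exp_ne_zero _))]

theorem exists_norm_le_exp [Finite ι] (h : ListsZeros F b) (hF : Differentiable ℂ F)
    (h0 : F 0 ≠ 0) (hσ : entireOrder F < 2) :
    ∃ A : ℝ, ∀ s, ‖F s‖ ≤ ‖F 0‖ * Real.exp (A * ‖s‖) := by
  cases nonempty_fintype ι
  refine ⟨‖logDeriv F 0‖ + ∑ i, 2 * ‖b i‖⁻¹, fun s => ?_⟩
  calc ‖F s‖ = ‖F 0‖ * (‖Complex.exp (logDeriv F 0 * s)‖ *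
        ∏ i, ‖(1 - s / b i) * Complex.exp (s / b i)‖) := by
        rw [h.eq_mul_tprod hF h0 hσ s, tprod_fintype, norm_mul, norm_mul, norm_prod, mul_assoc]
    _ ≤ ‖F 0‖ * (Real.exp ‖logDeriv F 0 * s‖ * ∏ i, Real.exp (2 * ‖s / b i‖)) := by
        gcongr
        · exact Complex.norm_exp_le_exp_norm _
        · exact norm_one_sub_mul_exp_le _
    _ = ‖F 0‖ * Real.exp ((‖logDeriv F 0‖ + ∑ i, 2 * ‖b i‖⁻¹) * ‖s‖) := by
        rw [← Real.exp_sum, ← Real.exp_add, norm_mul, add_mul, Finset.sum_mul]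
        congr 3
        exact Finset.sum_congr rfl fun i _ => by rw [norm_div]; ring

end ListsZeros

end HadamardFactorization

section ZeroNumbering

variable {F : ℂ → ℂ}

theorem natCast_le_analyticOrderAt_conj (hF : Differentiable ℂ F)
    (hconj : ∀ s, F (starRingEnd ℂ s) = starRingEnd ℂ (F s)) {n : ℕ} {w : ℂ}
    (h : (n : ℕ∞) ≤ analyticOrderAt F w) : (n : ℕ∞) ≤ analyticOrderAt F (starRingEnd ℂ w) := by
  rw [natCast_le_analyticOrderAt (hF.analyticAt _)] at h ⊢
  obtain ⟨g, hg, hgF⟩ := h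
  have htendsto : Tendsto (starRingEnd ℂ) (𝓝 (starRingEnd ℂ w)) (𝓝 w) :=
    Complex.continuous_conj.tendsto' _ _ (Complex.conj_conj w)
  refine ⟨fun s => starRingEnd ℂ (g (starRingEnd ℂ s)), ?_, ?_⟩
  · rw [Complex.analyticAt_iff_eventually_differentiableAt] at hg ⊢
    filter_upwards [htendsto.eventually hg] with s hs
    have hs' := hs.conj_conj
    rwa [Complex.conj_conj] at hs'
  · filter_upwards [htendsto.eventually hgF] with s hs
    rw [hconj] at hs
    simpa using congrArg (starRingEnd ℂ) hs

theorem analyticOrderAt_conj (hF : Differentiable ℂ F)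
    (hconj : ∀ s, F (starRingEnd ℂ s) = starRingEnd ℂ (F s)) (z : ℂ) :
    analyticOrderAt F (starRingEnd ℂ z) = analyticOrderAt F z :=
  le_antisymm
    (ENat.forall_natCast_le_iff_le.mp fun _ hn =>
      Complex.conj_conj z ▸ natCast_le_analyticOrderAt_conj hF hconj hn)
    (ENat.forall_natCast_le_iff_le.mp fun _ => natCast_le_analyticOrderAt_conj hF hconj)

/-- The points of `U`, each repeated as often as the order of vanishing of `F` there; for entire
`F ≠ 0` these are the zeros of `F` in `U`, indexed with multiplicity. -/
abbrev ZeroIndex (F : ℂ → ℂ) (U : Set ℂ) : Type := Σ z : U, Fin (analyticOrderNatAt F z)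

theorem encard_zeroIndex_eq {U : Set ℂ} {z : ℂ} (hz : z ∈ U) (hfin : analyticOrderAt F z ≠ ⊤) :
    {i : ZeroIndex F U | (i.1 : ℂ) = z}.encard = analyticOrderAt F z := by
  have hrange : {i : ZeroIndex F U | (i.1 : ℂ) = z} = range (Sigma.mk ⟨z, hz⟩) := by
    ext ⟨⟨w, hw⟩, k⟩
    constructor
    · rintro (rfl : w = z)
      exact ⟨k, rfl⟩
    · rintro ⟨l, hl⟩
      exact congrArg (fun i : ZeroIndex F U => (i.1 : ℂ)) hl.symm
  rw [hrange, ← image_univ, sigma_mk_injective.encard_image, ← Nat.cast_analyticOrderNatAt hfin]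
  simp

theorem encard_zeroIndex_eq_zero {U : Set ℂ} {z : ℂ} (hz : z ∉ U) :
    {i : ZeroIndex F U | (i.1 : ℂ) = z}.encard = 0 := by
  rw [encard_eq_zero, eq_empty_iff_forall_notMem]
  rintro i rfl
  exact hz i.1.2

theorem listsZeros_zeroIndex (hF : Differentiable ℂ F) (h0 : F 0 ≠ 0) :
    ListsZeros F fun i : ZeroIndex F (F ⁻¹' {0}) => (i.1 : ℂ) := fun z => by
  by_cases hz : F z = 0
  · exact encard_zeroIndex_eq hz (analyticOrderAt_ne_top_of_apply_ne_zero hF h0 z)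
  · exact (encard_zeroIndex_eq_zero (F := F) (U := F ⁻¹' {0}) hz).trans
      ((hF.analyticAt z).analyticOrderAt_eq_zero.mpr hz).symm

theorem exists_norm_le_exp_of_finite_zeros (hF : Differentiable ℂ F) (h0 : F 0 ≠ 0)
    (hσ : entireOrder F < 2) (hfin : (F ⁻¹' {0}).Finite) :
    ∃ A : ℝ, ∀ s, ‖F s‖ ≤ ‖F 0‖ * Real.exp (A * ‖s‖) := by
  have := hfin.to_subtype
  exact (listsZeros_zeroIndex hF h0).exists_norm_le_exp hF h0 hσ

theorem infinite_zeros_im_pos (hconj : ∀ s, F (starRingEnd ℂ s) = starRingEnd ℂ (F s))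
    (hinf : {z | F z = 0 ∧ z.im ≠ 0}.Infinite) : {z | F z = 0 ∧ 0 < z.im}.Infinite := by
  refine fun hfin => hinf ((hfin.union (hfin.image (starRingEnd ℂ))).subset ?_)
  rintro z ⟨hz, him⟩
  rcases him.lt_or_gt with h | h
  · exact Or.inr ⟨starRingEnd ℂ z, ⟨by rw [hconj, hz, map_zero], by simpa using h⟩,
      Complex.conj_conj z⟩
  · exact Or.inl ⟨hz, h⟩

theorem exists_enumeration_zeros (hF : Differentiable ℂ F) (h0 : F 0 ≠ 0) {U : Set ℂ}
    (hinf : {z | F z = 0 ∧ z ∈ U}.Infinite) :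
    ∃ u : ℕ → ℂ, (∀ n, u n ∈ U) ∧ Monotone (fun n => ‖u n‖) ∧
      ∀ z ∈ U, {n | u n = z}.encard = analyticOrderAt F z := by
  have htop := analyticOrderAt_ne_top_of_apply_ne_zero hF h0
  have hfinite : ∀ R, {i : ZeroIndex F U | ‖(i.1 : ℂ)‖ ≤ R}.Finite := by
    refine finite_norm_le_of_encard_le hF h0 fun z => ?_
    by_cases hz : z ∈ U
    · exact (encard_zeroIndex_eq hz (htop z)).le
    · exact (encard_zeroIndex_eq_zero hz).trans_le zero_le
  have : Infinite (ZeroIndex F U) := by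
    refine not_finite_iff_infinite.mp fun _ =>
      hinf ((finite_range fun i : ZeroIndex F U => (i.1 : ℂ)).subset ?_)
    rintro z ⟨hz, hzU⟩
    have hfibre : {i : ZeroIndex F U | (i.1 : ℂ) = z}.Nonempty := by
      rw [← encard_ne_zero, encard_zeroIndex_eq hzU (htop z)]
      exact (hF.analyticAt z).analyticOrderAt_ne_zero.mpr hz
    exact hfibre
  obtain ⟨e, he⟩ := exists_equiv_nat_monotone (fun i : ZeroIndex F U => ‖(i.1 : ℂ)‖) hfinite
  refine ⟨fun n => (e n).1, fun n => (e n).1.2, he, fun z hz => ?_⟩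
  rw [← encard_zeroIndex_eq hz (htop z)]
  exact encard_preimage_of_bijective e.bijective {i | (i.1 : ℂ) = z}

/-- The two-sided sequence with the given value at `0`, `u` at positive and its conjugate at
negative indices. -/
def conjExtend (b₀ : ℝ) (u : ℕ → ℂ) : ℤ → ℂ
  | Int.ofNat 0 => b₀
  | Int.ofNat (n + 1) => u n
  | Int.negSucc n => starRingEnd ℂ (u n)

section conjExtend

variable {b₀ : ℝ} {u : ℕ → ℂ}

theorem conjExtend_neg (n : ℤ) : conjExtend b₀ u (-n) = starRingEnd ℂ (conjExtend b₀ u n) := by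
  rcases n with ((_ | n) | n)
  · exact (Complex.conj_ofReal b₀).symm
  · rfl
  · exact (Complex.conj_conj (u n)).symm

theorem im_conjExtend_pos_iff (hu : ∀ n, 0 < (u n).im) {n : ℤ} :
    0 < (conjExtend b₀ u n).im ↔ 0 < n := by
  rcases n with ((_ | n) | n)
  · simp [conjExtend]
  · exact iff_of_true (hu n) (Int.natCast_succ_pos n)
  · simpa [conjExtend] using (hu n).le

theorem im_conjExtend_eq_zero_iff (hu : ∀ n, 0 < (u n).im) {n : ℤ} :
    (conjExtend b₀ u n).im = 0 ↔ n = 0 := by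
  have hneg := im_conjExtend_pos_iff (b₀ := b₀) hu (n := -n)
  have hpos := im_conjExtend_pos_iff (b₀ := b₀) hu (n := n)
  rw [conjExtend_neg, Complex.conj_im] at hneg
  constructor <;> intro h
  · rw [h] at hpos hneg
    simp at hpos hneg
    omega
  · rw [h]
    exact Complex.ofReal_im b₀

theorem encard_conjExtend_eq_conj (z : ℂ) :
    {n | conjExtend b₀ u n = starRingEnd ℂ z}.encard = {n | conjExtend b₀ u n = z}.encard := by
  rw [← encard_preimage_of_bijective (Equiv.neg ℤ).bijective]
  congr 1
  ext n
  simp [conjExtend_neg, (starRingEnd ℂ).injective.eq_iff]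

theorem encard_conjExtend_eq_of_im_pos (hu : ∀ n, 0 < (u n).im) {z : ℂ} (hz : 0 < z.im) :
    {n | conjExtend b₀ u n = z}.encard = {n | u n = z}.encard := by
  have hinj : Function.Injective fun k : ℕ => Int.ofNat (k + 1) := fun m n h => by simpa using h
  rw [← hinj.encard_image]
  congr 1
  ext n
  constructor
  · rintro rfl
    obtain ⟨k, rfl⟩ := Int.eq_succ_of_zero_lt ((im_conjExtend_pos_iff hu).mp hz)
    exact ⟨k, rfl, rfl⟩
  · rintro ⟨k, hk, rfl⟩
    exact hk

theorem encard_conjExtend_eq_ofReal (hu : ∀ n, 0 < (u n).im) (x : ℝ) :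
    {n | conjExtend b₀ u n = x}.encard = if x = b₀ then 1 else 0 := by
  have hiff (n : ℤ) : conjExtend b₀ u n = x ↔ n = 0 ∧ x = b₀ := by
    constructor
    · intro hn
      obtain rfl := (im_conjExtend_eq_zero_iff hu).mp (hn ▸ Complex.ofReal_im x)
      exact ⟨rfl, (Complex.ofReal_injective hn).symm⟩
    · rintro ⟨rfl, rfl⟩
      rfl
  simp only [hiff]
  split_ifs with hx <;> simp [hx]

end conjExtend

theorem exists_isZeroNumbering (hF : Differentiable ℂ F) (h0 : F 0 ≠ 0)
    (hconj : ∀ s, F (starRingEnd ℂ s) = starRingEnd ℂ (F s)) {b₀ : ℝ}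
    (hreal : ∀ x : ℝ, F x = 0 ↔ x = b₀) (hsimple : analyticOrderAt F b₀ = 1)
    (hinf : {z | F z = 0 ∧ z.im ≠ 0}.Infinite) : ∃ b : ℤ → ℂ, IsZeroNumbering F b := by
  obtain ⟨u, hu, hmono, hmult⟩ := exists_enumeration_zeros (U := {z | 0 < z.im}) hF h0
    (infinite_zeros_im_pos hconj hinf)
  refine ⟨conjExtend b₀ u, (im_conjExtend_eq_zero_iff hu).mpr rfl,
    fun n hn => (im_conjExtend_eq_zero_iff hu).not.mpr hn, conjExtend_neg, fun n hn => ?_,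
    fun z => ?_⟩
  · obtain ⟨k, rfl⟩ := Int.eq_succ_of_zero_lt hn
    exact hmono k.le_succ
  · rcases lt_trichotomy z.im 0 with hz | hz | hz
    · have hz' : 0 < (starRingEnd ℂ z).im := by simpa using hz
      rw [← encard_conjExtend_eq_conj, encard_conjExtend_eq_of_im_pos hu hz', hmult _ hz',
        analyticOrderAt_conj hF hconj]
    · lift z to ℝ using hz
      rw [encard_conjExtend_eq_ofReal hu]
      split_ifs with hx
      · rw [hx, hsimple]
      · rw [(hF.analyticAt _).analyticOrderAt_eq_zero.mpr ((hreal z).not.mpr hx)]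
    · rw [encard_conjExtend_eq_of_im_pos hu hz, hmult z hz]

end ZeroNumbering

section DecayingWeights

/-- A continuous positive weight on `[1, ∞)` of exponential decay; its values on `(-∞, 1)` are
arbitrary. -/
structure IsDecayingWeight (f : ℝ → ℝ) : Prop where
  continuousOn : ContinuousOn f (Ici 1)
  pos : ∀ x, 1 ≤ x → 0 < f x
  exists_isBigO : ∃ c > 0, f =O[atTop] fun x => Real.exp (-c * x)

/-- The truncated moment `∫_1^∞ x^a f(x) dx/x`. -/
noncomputable def tailMoment (f : ℝ → ℝ) (a : ℝ) : ℝ := ∫ x in Ioi 1, x ^ (a - 1) * f x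

/-- The truncated Mellin transform `∫_1^∞ x^s f(x) dx/x`. -/
noncomputable def tailMellin (f : ℝ → ℝ) (s : ℂ) : ℂ := ∫ x in Ioi (1 : ℝ), (x : ℂ) ^ (s - 1) * f x

variable {f : ℝ → ℝ}

theorem tailMellin_ofReal (f : ℝ → ℝ) (a : ℝ) : tailMellin f a = tailMoment f a := by
  rw [tailMellin, tailMoment, ← integral_complex_ofReal]
  refine setIntegral_congr_fun measurableSet_Ioi fun x hx => ?_
  simp [Complex.ofReal_cpow (one_pos.trans hx).le]

theorem tailMellin_conj (f : ℝ → ℝ) (s : ℂ) :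
    tailMellin f (starRingEnd ℂ s) = starRingEnd ℂ (tailMellin f s) := by
  rw [tailMellin, tailMellin, ← integral_conj]
  refine setIntegral_congr_fun measurableSet_Ioi fun x hx => ?_
  have harg : Complex.arg x ≠ Real.pi := by
    rw [Complex.arg_ofReal_of_nonneg (one_pos.trans hx).le]
    exact Real.pi_pos.ne
  have hcpow := Complex.cpow_conj x (s - 1) harg
  rw [map_sub, map_one, Complex.conj_ofReal] at hcpow
  simp only [hcpow, map_mul, Complex.conj_ofReal]

theorem tailMellin_eq_mellin (f : ℝ → ℝ) :
    tailMellin f = mellin ((Ioi 1).indicator fun x => (f x : ℂ)) := by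
  ext s
  have hIoi : Ioi (0 : ℝ) ∩ Ioi 1 = Ioi 1 := by simp [Ioi_inter_Ioi]
  simp only [mellin, tailMellin, smul_eq_mul]
  rw [← hIoi, ← setIntegral_indicator measurableSet_Ioi]
  refine integral_congr_ae (ae_of_all _ fun x => ?_)
  rw [hIoi]
  exact indicator_mul_right (Ioi 1) (fun x : ℝ => (x : ℂ) ^ (s - 1)) _

namespace IsDecayingWeight

theorem const_mul_exp {c : ℝ} (hc : 0 < c) : IsDecayingWeight fun x => Real.exp (-c * x) where
  continuousOn := by fun_prop
  pos _ _ := Real.exp_pos _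
  exists_isBigO := ⟨c, hc, Asymptotics.isBigO_refl _ _⟩

theorem exists_exp_mul (hf : IsDecayingWeight f) :
    ∃ c > 0, IsDecayingWeight fun x => Real.exp (c * x) * f x := by
  obtain ⟨c, hc, hO⟩ := hf.exists_isBigO
  refine ⟨c / 2, half_pos hc, ContinuousOn.mul (by fun_prop) hf.continuousOn,
    fun x hx => mul_pos (Real.exp_pos _) (hf.pos x hx), c / 2, half_pos hc, ?_⟩
  refine ((Asymptotics.isBigO_refl (fun x => Real.exp (c / 2 * x)) atTop).mul hO).congr_right
    fun x => ?_
  rw [← Real.exp_add]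
  congr 1
  ring

theorem integrableOn_rpow_mul (hf : IsDecayingWeight f) (a : ℝ) :
    IntegrableOn (fun x => x ^ a * f x) (Ioi 1) := by
  obtain ⟨c, hc, hO⟩ := hf.exists_isBigO
  refine integrable_of_isBigO_exp_neg (b := c / 2) (half_pos hc) ?_ ?_
  · refine ContinuousOn.mul (fun x hx => ?_) hf.continuousOn
    exact (Real.continuousAt_rpow_const _ _
      (Or.inl (one_pos.trans_le hx).ne')).continuousWithinAt
  · refine ((isLittleO_rpow_exp_pos_mul_atTop a (half_pos hc)).isBigO.mul hO).congr_right
      fun x => ?_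
    rw [← Real.exp_add]
    congr 1
    ring

theorem integrableOn (hf : IsDecayingWeight f) : IntegrableOn f (Ioi 1) := by
  simpa using hf.integrableOn_rpow_mul 0

theorem integral_rpow_mul_pos (hf : IsDecayingWeight f) (a : ℝ) {K : ℝ} (hK : 1 ≤ K) :
    0 < ∫ x in Ioi K, x ^ a * f x := by
  have hpos : ∀ x ∈ Ioi K, 0 < x ^ a * f x := fun x hx =>
    mul_pos (Real.rpow_pos_of_pos (by linarith [mem_Ioi.mp hx]) a)
      (hf.pos x (hK.trans (le_of_lt hx)))
  rw [setIntegral_pos_iff_support_of_nonneg_ae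
    ((ae_restrict_mem measurableSet_Ioi).mono fun x hx => (hpos x hx).le)
    ((hf.integrableOn_rpow_mul a).mono_set (Ioi_subset_Ioi hK))]
  have hsub : Ioi K ⊆ Function.support fun x => x ^ a * f x := fun x hx => (hpos x hx).ne'
  rw [inter_eq_right.mpr hsub, Real.volume_Ioi]
  exact ENNReal.zero_lt_top

theorem tailMoment_pos (hf : IsDecayingWeight f) (a : ℝ) : 0 < tailMoment f a :=
  hf.integral_rpow_mul_pos (a - 1) le_rfl

theorem monotone_tailMoment (hf : IsDecayingWeight f) : Monotone (tailMoment f) :=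
  fun a b hab => setIntegral_mono_on (hf.integrableOn_rpow_mul _) (hf.integrableOn_rpow_mul _)
    measurableSet_Ioi fun x hx => by
      have hx : 1 ≤ x := le_of_lt hx
      have := hf.pos x hx
      gcongr

theorem tailMoment_le_mul {g : ℝ → ℝ} (hf : IsDecayingWeight f) (hg : IsDecayingWeight g)
    {C : ℝ} (hfg : ∀ x, 1 ≤ x → f x ≤ C * g x) (a : ℝ) :
    tailMoment f a ≤ C * tailMoment g a := by
  rw [tailMoment, tailMoment, ← integral_const_mul]
  refine setIntegral_mono_on (hf.integrableOn_rpow_mul _)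
    ((hg.integrableOn_rpow_mul _).const_mul _) measurableSet_Ioi fun x hx => ?_
  rw [mul_left_comm]
  have hx : 1 < x := hx
  exact mul_le_mul_of_nonneg_left (hfg x hx.le) (by positivity)

theorem exists_mul_rpow_le_tailMoment (hf : IsDecayingWeight f) {K : ℝ} (hK : 1 ≤ K) :
    ∃ c > 0, ∀ a ≥ 0, c * K ^ a ≤ tailMoment f a := by
  refine ⟨∫ x in Ioi K, x ^ (-1 : ℝ) * f x, hf.integral_rpow_mul_pos _ hK, fun a ha => ?_⟩
  have hsub : Ioi K ⊆ Ioi 1 := Ioi_subset_Ioi hK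
  calc (∫ x in Ioi K, x ^ (-1 : ℝ) * f x) * K ^ a
      = ∫ x in Ioi K, x ^ (-1 : ℝ) * f x * K ^ a := (integral_mul_const _ _).symm
    _ ≤ ∫ x in Ioi K, x ^ (a - 1) * f x := by
        refine setIntegral_mono_on (((hf.integrableOn_rpow_mul _).mono_set hsub).mul_const _)
          ((hf.integrableOn_rpow_mul _).mono_set hsub) measurableSet_Ioi fun x hx => ?_
        have hKx : K < x := hx
        have hfx := hf.pos x (hK.trans hKx.le)
        have hx0 : 0 < x := by linarith
        rw [sub_eq_neg_add, Real.rpow_add hx0, mul_right_comm]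
        gcongr
    _ ≤ tailMoment f a := by
        refine setIntegral_mono_set (hf.integrableOn_rpow_mul _) ?_ hsub.eventuallyLE
        refine (ae_restrict_mem measurableSet_Ioi).mono fun x hx => ?_
        have hx : 1 < x := hx
        exact mul_nonneg (by positivity) (hf.pos x hx.le).le

theorem tailMoment_le_rpow_mul (hf : IsDecayingWeight f) {c : ℝ} (hc : 0 < c)
    (hfc : IsDecayingWeight fun x => Real.exp (c * x) * f x) {a : ℝ} (ha : 0 < a) :
    tailMoment f a ≤ (a / c) ^ a * tailMoment (fun x => Real.exp (c * x) * f x) 0 := by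
  rw [tailMoment, tailMoment, ← integral_const_mul]
  refine setIntegral_mono_on (hf.integrableOn_rpow_mul _)
    ((hfc.integrableOn_rpow_mul _).const_mul _) measurableSet_Ioi fun x hx => ?_
  have hx1 : 1 < x := hx
  have hx0 : 0 < x := one_pos.trans hx1
  have hfx := hf.pos x hx1.le
  have hrpow : x ^ a ≤ (a / c) ^ a * Real.exp (c * x) :=
    calc x ^ a = (a / c) ^ a * (c * x / a) ^ a := by
          rw [← Real.mul_rpow (by positivity) (by positivity)]
          congr 1
          field_simp
      _ ≤ (a / c) ^ a * Real.exp (c * x / a) ^ a := by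
          gcongr
          linarith [Real.add_one_le_exp (c * x / a)]
      _ = (a / c) ^ a * Real.exp (c * x) := by rw [← Real.exp_mul, div_mul_cancel₀ _ ha.ne']
  calc x ^ (a - 1) * f x = x ^ a * (x ^ (0 - 1 : ℝ) * f x) := by
        rw [← mul_assoc, ← Real.rpow_add hx0]
        ring_nf
    _ ≤ (a / c) ^ a * Real.exp (c * x) * (x ^ (0 - 1 : ℝ) * f x) := by gcongr
    _ = (a / c) ^ a * (x ^ (0 - 1 : ℝ) * (Real.exp (c * x) * f x)) := by ring

theorem norm_tailMellin_le (hf : IsDecayingWeight f) (s : ℂ) :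
    ‖tailMellin f s‖ ≤ tailMoment f s.re := by
  refine norm_integral_le_of_norm_le (hf.integrableOn_rpow_mul _) ?_
  refine (ae_restrict_mem measurableSet_Ioi).mono fun x hx => le_of_eq ?_
  rw [norm_mul, Complex.norm_cpow_eq_rpow_re_of_pos (one_pos.trans hx), Complex.norm_real,
    Real.norm_of_nonneg (hf.pos x (le_of_lt hx)).le, Complex.sub_re, Complex.one_re]

theorem differentiable_tailMellin (hf : IsDecayingWeight f) : Differentiable ℂ (tailMellin f) := by
  intro s
  obtain ⟨c, hc, hO⟩ := hf.exists_isBigO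
  rw [tailMellin_eq_mellin]
  refine mellin_differentiableAt_of_isBigO_rpow_exp (b := s.re - 1) hc ?_ ?_ ?_ (by linarith)
  · have hint : IntegrableOn (fun x => (f x : ℂ)) (Ioi 1) := hf.integrableOn.ofReal
    exact ((integrable_indicator_iff measurableSet_Ioi).mpr
      hint).locallyIntegrable.locallyIntegrableOn _
  · refine (Complex.isBigO_ofReal_left.mpr hO).congr' ?_ EventuallyEq.rfl
    filter_upwards [eventually_gt_atTop 1] with x hx
    exact (indicator_of_mem (mem_Ioi.mpr hx) fun x => (f x : ℂ)).symm
  · refine EventuallyEq.trans_isBigO (f₂ := fun _ => 0) ?_ (Asymptotics.isBigO_zero _ _)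
    filter_upwards [mem_nhdsWithin_of_mem_nhds (Iio_mem_nhds one_pos)] with x hx
    exact indicator_of_notMem (notMem_Ioi.mpr (le_of_lt hx)) _

end IsDecayingWeight

end DecayingWeights

section EntireOrder

variable {F : ℂ → ℂ} {σ : NNReal}

theorem entireOrder_le
    (h : ∀ ρ : ℝ, σ < ρ → ∀ᶠ z in cobounded ℂ, ‖F z‖ ≤ Real.exp (‖z‖ ^ ρ)) :
    entireOrder F ≤ σ := by
  refine ENNReal.le_of_forall_pos_le_add fun ε hε _ => (iInf₂_le (σ + ε) (h _ ?_)).trans (by simp)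
  exact_mod_cast lt_add_of_pos_right σ hε

theorem le_entireOrder (h : ∃ᶠ z in cobounded ℂ, Real.exp (‖z‖ ^ (σ : ℝ)) < ‖F z‖) :
    σ ≤ entireOrder F := by
  refine le_iInf₂ fun ρ hρ => ?_
  by_contra! hlt
  have hρσ : (ρ : ℝ) ≤ σ := by exact_mod_cast hlt.le
  obtain ⟨z, hlarge, hsmall, hz⟩ := (h.and_eventually
    (hρ.and (tendsto_norm_cobounded_atTop.eventually_ge_atTop 1))).exists
  have hpow := Real.rpow_le_rpow_of_exponent_le hz hρσ
  exact absurd (hlarge.trans_le hsmall) (Real.exp_le_exp.mpr hpow).not_gt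

theorem eventually_add_mul_le_exp_rpow (A B : ℝ) {p q : ℝ} (hp : 0 < p) (hq : 0 < q) :
    ∀ᶠ r : ℝ in atTop, A + B * r ≤ Real.exp (q * r ^ p) := by
  have hexp : (fun r : ℝ => r) =o[atTop] fun r => Real.exp (q * r ^ p) := by
    refine ((isLittleO_rpow_exp_pos_mul_atTop p⁻¹ hq).comp_tendsto
      (tendsto_rpow_atTop hp)).congr' ?_ EventuallyEq.rfl
    filter_upwards [eventually_ge_atTop 0] with r hr
    exact Real.rpow_rpow_inv hr hp.ne'
  have hconst : (fun _ : ℝ => A) =o[atTop] fun r => Real.exp (q * r ^ p) :=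
    (Asymptotics.isLittleO_const_id_atTop A).trans hexp
  filter_upwards [(hconst.add (hexp.const_mul_left B)).bound one_pos] with r hr
  rw [one_mul, Real.norm_of_nonneg (Real.exp_pos _).le] at hr
  exact (le_abs_self _).trans hr

end EntireOrder

section LavrikFunction

/-- The function `-1 + s ∫_1^∞ x^{s/2} f(x) dx/x`; it is `s Λ(s)` for the weight `f = ψ`. -/
noncomputable def lavrikF (f : ℝ → ℝ) (s : ℂ) : ℂ := -1 + s * tailMellin f (s / 2)

variable {f : ℝ → ℝ}

@[simp]
theorem lavrikF_zero (f : ℝ → ℝ) : lavrikF f 0 = -1 := by simp [lavrikF]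

theorem lavrikF_zero_ne_zero (f : ℝ → ℝ) : lavrikF f 0 ≠ 0 := by simp

theorem lavrikF_conj (f : ℝ → ℝ) (s : ℂ) :
    lavrikF f (starRingEnd ℂ s) = starRingEnd ℂ (lavrikF f s) := by
  have hhalf : starRingEnd ℂ s / 2 = starRingEnd ℂ (s / 2) := by
    rw [map_div₀, Complex.conj_ofNat]
  simp [lavrikF, hhalf, tailMellin_conj, -map_div₀]

theorem lavrikF_ofReal (f : ℝ → ℝ) (r : ℝ) :
    lavrikF f r = ((r * tailMoment f (r / 2) - 1 : ℝ) : ℂ) := by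
  have hhalf : (r / 2 : ℂ) = ((r / 2 : ℝ) : ℂ) := by push_cast; rfl
  rw [lavrikF, hhalf, tailMellin_ofReal]
  push_cast
  ring

theorem lavrikF_ofReal_eq_zero_iff {r : ℝ} :
    lavrikF f r = 0 ↔ r * tailMoment f (r / 2) = 1 := by
  rw [lavrikF_ofReal, Complex.ofReal_eq_zero, sub_eq_zero]

namespace IsDecayingWeight

theorem hasDerivAt_lavrikF (hf : IsDecayingWeight f) (s : ℂ) :
    HasDerivAt (lavrikF f) (tailMellin f (s / 2) + s * (deriv (tailMellin f) (s / 2) / 2)) s := by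
  have hhalf : HasDerivAt (fun s : ℂ => s / 2) (1 / 2) s := (hasDerivAt_id' s).div_const 2
  have hcomp := (hf.differentiable_tailMellin (s / 2)).hasDerivAt.comp s hhalf
  refine (((hasDerivAt_id' s).mul hcomp).const_add (-1)).congr_deriv ?_
  rw [Function.comp_apply]
  ring

theorem differentiable_lavrikF (hf : IsDecayingWeight f) : Differentiable ℂ (lavrikF f) :=
  fun s => (hf.hasDerivAt_lavrikF s).differentiableAt

theorem logDeriv_lavrikF_zero (hf : IsDecayingWeight f) :
    logDeriv (lavrikF f) 0 = -tailMellin f 0 := by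
  simp [logDeriv_apply, (hf.hasDerivAt_lavrikF 0).deriv, div_neg]

theorem eventually_norm_lavrikF_le (hf : IsDecayingWeight f) {ρ : ℝ} (hρ : 1 < ρ) :
    ∀ᶠ z in cobounded ℂ, ‖lavrikF f z‖ ≤ Real.exp (‖z‖ ^ ρ) := by
  obtain ⟨c, hc, hfc⟩ := hf.exists_exp_mul
  set C := tailMoment (fun x => Real.exp (c * x) * f x) 0
  have hC : 0 < C := hfc.tailMoment_pos 0
  have hbase := eventually_add_mul_le_exp_rpow 0 (2 * c)⁻¹ (sub_pos.mpr hρ) one_pos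
  have hlinear := eventually_add_mul_le_exp_rpow 1 C (p := ρ) (by linarith) one_half_pos
  filter_upwards [tendsto_norm_cobounded_atTop.eventually (hbase.and hlinear),
    tendsto_norm_cobounded_atTop.eventually_gt_atTop 0] with z ⟨hbase, hlinear⟩ hz
  set r := ‖z‖
  have hmellin : ‖tailMellin f (z / 2)‖ ≤ (r / 2 / c) ^ (r / 2) * C := by
    refine (hf.norm_tailMellin_le _).trans ((hf.monotone_tailMoment ?_).trans
      (hf.tailMoment_le_rpow_mul hc hfc (by positivity)))
    simpa using Complex.re_le_norm (z / 2)
  have hpow : (r / 2 / c) ^ (r / 2) ≤ Real.exp (1 / 2 * r ^ ρ) :=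
    calc (r / 2 / c) ^ (r / 2) ≤ Real.exp (1 * r ^ (ρ - 1)) ^ (r / 2) := by
          gcongr
          refine le_of_eq_of_le ?_ hbase
          field_simp
          ring
      _ = Real.exp (1 / 2 * r ^ ρ) := by
          rw [← Real.exp_mul, Real.rpow_sub_one hz.ne']
          congr 1
          field_simp
  have hone : 1 ≤ Real.exp (1 / 2 * r ^ ρ) := Real.one_le_exp (by positivity)
  calc ‖lavrikF f z‖ ≤ 1 + r * ‖tailMellin f (z / 2)‖ := by
        refine (norm_add_le _ _).trans ?_
        rw [norm_neg, norm_one, norm_mul]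
    _ ≤ Real.exp (1 / 2 * r ^ ρ) + r * (Real.exp (1 / 2 * r ^ ρ) * C) := by
        gcongr
        exact hmellin.trans (by gcongr)
    _ = (1 + C * r) * Real.exp (1 / 2 * r ^ ρ) := by ring
    _ ≤ Real.exp (1 / 2 * r ^ ρ) * Real.exp (1 / 2 * r ^ ρ) := by gcongr
    _ = Real.exp (r ^ ρ) := by rw [← Real.exp_add]; congr 1; ring

theorem eventually_exp_mul_lt_norm_lavrikF (hf : IsDecayingWeight f) (A : ℝ) :
    ∀ᶠ r : ℝ in atTop, Real.exp (A * r) < ‖lavrikF f r‖ := by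
  set B := max A 1
  obtain ⟨c, hc, hcK⟩ := hf.exists_mul_rpow_le_tailMoment (K := Real.exp (2 * B))
    (Real.one_le_exp (by positivity))
  filter_upwards [eventually_gt_atTop 0, eventually_ge_atTop (2 / c)] with r hr hrc
  have hE : 1 < Real.exp (B * r) := Real.one_lt_exp_iff.mpr (by positivity)
  have hmoment : 2 * Real.exp (B * r) ≤ r * tailMoment f (r / 2) :=
    calc 2 * Real.exp (B * r) ≤ r * c * Real.exp (B * r) := by
          gcongr
          exact (div_le_iff₀ hc).mp hrc
      _ = r * (c * Real.exp (2 * B) ^ (r / 2)) := by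
          rw [← Real.exp_mul, mul_assoc]
          ring_nf
      _ ≤ r * tailMoment f (r / 2) := by
          gcongr
          exact hcK _ (by positivity)
  calc Real.exp (A * r) ≤ Real.exp (B * r) := by gcongr; exact le_max_left A 1
    _ < r * tailMoment f (r / 2) - 1 := by linarith
    _ ≤ ‖lavrikF f r‖ := by
        rw [lavrikF_ofReal, Complex.norm_real]
        exact le_abs_self _

theorem entireOrder_lavrikF (hf : IsDecayingWeight f) : entireOrder (lavrikF f) = 1 := by
  have hofReal : Tendsto (fun r : ℝ => (r : ℂ)) atTop (cobounded ℂ) := by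
    rw [← comap_norm_atTop, tendsto_comap_iff]
    exact tendsto_abs_atTop_atTop.congr fun r => (Complex.norm_real r).symm
  refine le_antisymm (entireOrder_le (σ := 1) fun ρ hρ => hf.eventually_norm_lavrikF_le hρ)
    (le_entireOrder (σ := 1) (hofReal.frequently (Eventually.frequently ?_)))
  filter_upwards [hf.eventually_exp_mul_lt_norm_lavrikF 1, eventually_ge_atTop 0] with r hr hr0
  simpa [abs_of_nonneg hr0] using hr

theorem entireOrder_lavrikF_lt_two (hf : IsDecayingWeight f) : entireOrder (lavrikF f) < 2 :=
  hf.entireOrder_lavrikF ▸ ENNReal.one_lt_two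

theorem infinite_zeros_lavrikF (hf : IsDecayingWeight f) : (lavrikF f ⁻¹' {0}).Infinite := by
  intro hfin
  obtain ⟨A, hA⟩ := exists_norm_le_exp_of_finite_zeros hf.differentiable_lavrikF
    (lavrikF_zero_ne_zero f) hf.entireOrder_lavrikF_lt_two hfin
  obtain ⟨r, hr, hr0⟩ :=
    ((hf.eventually_exp_mul_lt_norm_lavrikF A).and (eventually_ge_atTop 0)).exists
  refine absurd (hA r) (lt_of_eq_of_lt ?_ hr).not_ge
  simp [abs_of_nonneg hr0]

theorem pos_of_lavrikF_ofReal_eq_zero (hf : IsDecayingWeight f) {r : ℝ} (h : lavrikF f r = 0) :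
    0 < r :=
  pos_of_mul_pos_left ((lavrikF_ofReal_eq_zero_iff.mp h).symm ▸ one_pos)
    (hf.tailMoment_pos (r / 2)).le

theorem strictMonoOn_mul_tailMoment (hf : IsDecayingWeight f) :
    StrictMonoOn (fun r => r * tailMoment f (r / 2)) (Ici 0) := fun r hr t _ hrt =>
  mul_lt_mul_of_lt_of_le_of_nonneg_of_pos hrt (hf.monotone_tailMoment (by linarith)) hr
    (hf.tailMoment_pos _)

theorem eq_of_lavrikF_ofReal_eq_zero (hf : IsDecayingWeight f) {r t : ℝ} (hr : lavrikF f r = 0)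
    (ht : lavrikF f t = 0) : r = t :=
  hf.strictMonoOn_mul_tailMoment.injOn (hf.pos_of_lavrikF_ofReal_eq_zero hr).le
    (hf.pos_of_lavrikF_ofReal_eq_zero ht).le
    ((lavrikF_ofReal_eq_zero_iff.mp hr).trans (lavrikF_ofReal_eq_zero_iff.mp ht).symm)

theorem infinite_nonreal_zeros_lavrikF (hf : IsDecayingWeight f) :
    {z | lavrikF f z = 0 ∧ z.im ≠ 0}.Infinite := by
  have hreal : {z | lavrikF f z = 0 ∧ z.im = 0}.Subsingleton := by
    rintro z ⟨hz, hzim⟩ w ⟨hw, hwim⟩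
    lift z to ℝ using hzim
    lift w to ℝ using hwim
    exact congrArg _ (hf.eq_of_lavrikF_ofReal_eq_zero hz hw)
  refine (hf.infinite_zeros_lavrikF.sdiff hreal.finite).mono ?_
  rintro z ⟨hz, hz'⟩
  exact ⟨hz, fun him => hz' ⟨hz, him⟩⟩

theorem exists_real_zero_lavrikF (hf : IsDecayingWeight f) {x y : ℝ} (hxy : x ≤ y)
    (hx : x * tailMoment f (x / 2) < 1) (hy : 1 < y * tailMoment f (y / 2)) :
    ∃ b ∈ Ioo x y, ∀ t : ℝ, lavrikF f t = 0 ↔ t = b := by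
  have hcont : Continuous fun r => r * tailMoment f (r / 2) := by
    have hre : (fun r : ℝ => (lavrikF f r).re + 1) = fun r => r * tailMoment f (r / 2) := by
      ext r
      rw [lavrikF_ofReal, Complex.ofReal_re, sub_add_cancel]
    rw [← hre]
    exact (Complex.continuous_re.comp
      (hf.differentiable_lavrikF.continuous.comp Complex.continuous_ofReal)).add continuous_const
  obtain ⟨b, hb, hb1⟩ := intermediate_value_Ioo hxy hcont.continuousOn ⟨hx, hy⟩
  have hb0 : lavrikF f b = 0 := lavrikF_ofReal_eq_zero_iff.mpr hb1
  exact ⟨b, hb, fun t => ⟨fun ht => hf.eq_of_lavrikF_ofReal_eq_zero ht hb0, fun ht => ht ▸ hb0⟩⟩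

theorem analyticOrderAt_lavrikF_of_real_zero (hf : IsDecayingWeight f) {r : ℝ}
    (h : lavrikF f r = 0) : analyticOrderAt (lavrikF f) r = 1 := by
  refine (hf.differentiable_lavrikF.analyticAt _).analyticOrderAt_eq_one_of_zero_deriv_ne_zero h
    fun hderiv => ?_
  have hr := hf.pos_of_lavrikF_ofReal_eq_zero h
  have hhalf : (r / 2 : ℂ) = ((r / 2 : ℝ) : ℂ) := by push_cast; rfl
  have hmoment : HasDerivAt (tailMoment f) (deriv (tailMellin f) (r / 2)).re (r / 2) := by
    have := (hf.differentiable_tailMellin ((r / 2 : ℝ) : ℂ)).hasDerivAt.real_of_complex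
    simpa only [tailMellin_ofReal, Complex.ofReal_re, ← hhalf] using this
  have hnonneg : 0 ≤ (deriv (tailMellin f) (r / 2)).re :=
    hmoment.deriv ▸ hf.monotone_tailMoment.deriv_nonneg
  rw [(hf.hasDerivAt_lavrikF r).deriv] at hderiv
  have hre := congrArg Complex.re hderiv
  rw [Complex.add_re, Complex.re_ofReal_mul, Complex.div_ofNat_re, Complex.zero_re, hhalf,
    tailMellin_ofReal, Complex.ofReal_re, ← hhalf] at hre
  have := hf.tailMoment_pos (r / 2)
  have : 0 ≤ r * ((deriv (tailMellin f) (r / 2)).re / 2) := by positivity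
  linarith

theorem lavrikF_eq_mul_tprod (hf : IsDecayingWeight f) {ι : Type*} {b : ι → ℂ}
    (hb : ListsZeros (lavrikF f) b) (s : ℂ) :
    lavrikF f s = -Complex.exp (-tailMellin f 0 * s) *
      ∏' i, (1 - s / b i) * Complex.exp (s / b i) := by
  rw [hb.eq_mul_tprod hf.differentiable_lavrikF (lavrikF_zero_ne_zero f)
    hf.entireOrder_lavrikF_lt_two, hf.logDeriv_lavrikF_zero, lavrikF_zero, neg_one_mul]

theorem multipliable_zeros_lavrikF (hf : IsDecayingWeight f) {ι : Type*} {b : ι → ℂ}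
    (hb : ListsZeros (lavrikF f) b) (s : ℂ) :
    Multipliable fun i => (1 - s / b i) * Complex.exp (s / b i) :=
  (hb.hasProd_one_sub_div_mul_exp hf.differentiable_lavrikF (lavrikF_zero_ne_zero f)
    hf.entireOrder_lavrikF_lt_two s).multipliable

end IsDecayingWeight

end LavrikFunction

section IncompleteGamma

/-- The integral `∫_1^∞ x^{a-1} e^{-cx} dx`, which for `c > 0` is `c^{-a}` times the upper
incomplete gamma function at `(a, c)`. -/
noncomputable def incGamma (c a : ℝ) : ℝ := tailMoment (fun x => Real.exp (-c * x)) a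

theorem mul_incGamma {c : ℝ} (hc : 0 < c) (a : ℝ) :
    c * incGamma c a = Real.exp (-c) + (a - 1) * incGamma c (a - 1) := by
  have hderiv : ∀ x ∈ Ici (1 : ℝ), HasDerivAt (fun x : ℝ => -(x ^ (a - 1) * Real.exp (-c * x)))
      (c * (x ^ (a - 1) * Real.exp (-c * x)) -
        (a - 1) * (x ^ (a - 1 - 1) * Real.exp (-c * x))) x := by
    intro x hx
    have hrpow := Real.hasDerivAt_rpow_const (p := a - 1) (Or.inl (one_pos.trans_le hx).ne')
    have hexp : HasDerivAt (fun x : ℝ => Real.exp (-c * x)) (Real.exp (-c * x) * (-c * 1)) x :=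
      ((hasDerivAt_id' x).const_mul (-c)).exp
    refine (hrpow.mul hexp).neg.congr_deriv ?_
    ring
  have hweight := IsDecayingWeight.const_mul_exp hc
  have hint := (hweight.integrableOn_rpow_mul (a - 1)).const_mul c
  have hint' := (hweight.integrableOn_rpow_mul (a - 1 - 1)).const_mul (a - 1)
  have hparts := integral_Ioi_of_hasDerivAt_of_tendsto' hderiv (hint.sub hint')
    (by simpa using (tendsto_rpow_mul_exp_neg_mul_atTop_nhds_zero (a - 1) c hc).neg)
  rw [integral_sub hint hint', integral_const_mul, integral_const_mul, Real.one_rpow, one_mul,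
    mul_one] at hparts
  rw [incGamma, incGamma, tailMoment, tailMoment]
  linarith

theorem exp_neg_pi_mem_Ioo : Real.exp (-Real.pi) ∈ Ioo (0.043213 : ℝ) 0.043215 := by
  have hsplit : Real.exp Real.pi = Real.exp 1 ^ 3 * Real.exp (Real.pi - 3) := by
    rw [← Real.exp_nat_mul, ← Real.exp_add]
    congr 1
    push_cast
    ring
  have hupper : Real.exp (Real.pi - 3) < 1.15212 := by
    have hle : Real.exp (Real.pi - 3) ≤ Real.exp 0.141593 :=
      Real.exp_le_exp.mpr (by linarith [Real.pi_lt_d6])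
    have htaylor := Real.exp_bound' (x := 0.141593) (by norm_num) (by norm_num) (n := 5)
      (by norm_num)
    norm_num [Finset.sum_range_succ, Nat.factorial] at htaylor
    linarith
  have hlower : 1.15209 < Real.exp (Real.pi - 3) := by
    have hle : Real.exp 0.141592 ≤ Real.exp (Real.pi - 3) :=
      Real.exp_le_exp.mpr (by linarith [Real.pi_gt_d6])
    have htaylor := Real.sum_le_exp_of_nonneg (x := 0.141592) (by norm_num) 5
    norm_num [Finset.sum_range_succ, Nat.factorial] at htaylor
    linarith
  have he := Real.exp_one_gt_d9
  have he' := Real.exp_one_lt_d9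
  rw [Real.exp_neg, hsplit]
  constructor
  · rw [lt_inv_comm₀ (by norm_num) (by positivity)]
    calc Real.exp 1 ^ 3 * Real.exp (Real.pi - 3) < 2.7182818286 ^ 3 * 1.15212 := by gcongr
      _ < 0.043213⁻¹ := by norm_num
  · rw [inv_lt_comm₀ (by positivity) (by norm_num)]
    calc (0.043215 : ℝ)⁻¹ < 2.7182818283 ^ 3 * 1.15209 := by norm_num
      _ < Real.exp 1 ^ 3 * Real.exp (Real.pi - 3) := by gcongr

theorem incGamma_pi_pos (a : ℝ) : 0 < incGamma Real.pi a :=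
  (IsDecayingWeight.const_mul_exp Real.pi_pos).tailMoment_pos a

theorem incGamma_pi_le_of_eq_add_one {a v : ℝ} (b : ℝ) (hab : a = b + 1)
    (hv : 0.043215 + b * incGamma Real.pi b ≤ 3.141592 * v) : incGamma Real.pi a ≤ v := by
  have hrec := mul_incGamma Real.pi_pos a
  rw [hab, add_sub_cancel_right, ← hab] at hrec
  have hpi : 3.141592 * incGamma Real.pi a ≤ Real.pi * incGamma Real.pi a :=
    mul_le_mul_of_nonneg_right Real.pi_gt_d6.le (incGamma_pi_pos a).le
  linarith [exp_neg_pi_mem_Ioo.2]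

theorem le_incGamma_pi_of_eq_add_one {a v : ℝ} (b : ℝ) (hab : a = b + 1)
    (hv : 3.141593 * v ≤ 0.043213 + b * incGamma Real.pi b) : v ≤ incGamma Real.pi a := by
  have hrec := mul_incGamma Real.pi_pos a
  rw [hab, add_sub_cancel_right, ← hab] at hrec
  have hpi : Real.pi * incGamma Real.pi a ≤ 3.141593 * incGamma Real.pi a :=
    mul_le_mul_of_nonneg_right Real.pi_lt_d6.le (incGamma_pi_pos a).le
  linarith [exp_neg_pi_mem_Ioo.1]

-- For `b < 0` the recurrence turns a lower bound at `b` into an upper bound at `b + 1` and vice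
-- versa, so that already the bound `0 <` at a negative argument starts the iteration.
theorem incGamma_pi_at_left_le : incGamma Real.pi 5.6225 ≤ 0.08874 := by
  have h₀ : incGamma Real.pi (-1.3775) ≤ 0.013756 :=
    incGamma_pi_le_of_eq_add_one (-2.3775) (by norm_num) (by linarith [incGamma_pi_pos (-2.3775)])
  have h₁ : 0.007723 ≤ incGamma Real.pi (-0.3775) :=
    le_incGamma_pi_of_eq_add_one (-1.3775) (by norm_num) (by linarith)
  have h₂ : incGamma Real.pi 0.6225 ≤ 0.012828 :=
    incGamma_pi_le_of_eq_add_one (-0.3775) (by norm_num) (by linarith)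
  have h₃ : incGamma Real.pi 1.6225 ≤ 0.016298 :=
    incGamma_pi_le_of_eq_add_one 0.6225 (by norm_num) (by linarith)
  have h₄ : incGamma Real.pi 2.6225 ≤ 0.022173 :=
    incGamma_pi_le_of_eq_add_one 1.6225 (by norm_num) (by linarith)
  have h₅ : incGamma Real.pi 3.6225 ≤ 0.032266 :=
    incGamma_pi_le_of_eq_add_one 2.6225 (by norm_num) (by linarith)
  have h₆ : incGamma Real.pi 4.6225 ≤ 0.050961 :=
    incGamma_pi_le_of_eq_add_one 3.6225 (by norm_num) (by linarith)
  exact incGamma_pi_le_of_eq_add_one 4.6225 (by norm_num) (by linarith)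

theorem le_incGamma_pi_at_right : 0.088894 ≤ incGamma Real.pi 5.6275 := by
  have h₀ : incGamma Real.pi (-0.3725) ≤ 0.013756 :=
    incGamma_pi_le_of_eq_add_one (-1.3725) (by norm_num) (by linarith [incGamma_pi_pos (-1.3725)])
  have h₁ : 0.012124 ≤ incGamma Real.pi 0.6275 :=
    le_incGamma_pi_of_eq_add_one (-0.3725) (by norm_num) (by linarith)
  have h₂ : 0.016176 ≤ incGamma Real.pi 1.6275 :=
    le_incGamma_pi_of_eq_add_one 0.6275 (by norm_num) (by linarith)
  have h₃ : 0.022135 ≤ incGamma Real.pi 2.6275 :=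
    le_incGamma_pi_of_eq_add_one 1.6275 (by norm_num) (by linarith)
  have h₄ : 0.032267 ≤ incGamma Real.pi 3.6275 :=
    le_incGamma_pi_of_eq_add_one 2.6275 (by norm_num) (by linarith)
  have h₅ : 0.051012 ≤ incGamma Real.pi 4.6275 :=
    le_incGamma_pi_of_eq_add_one 3.6275 (by norm_num) (by linarith)
  exact le_incGamma_pi_of_eq_add_one 4.6275 (by norm_num) (by linarith)

end IncompleteGamma

section Psi

/-- The sum `∑_{n ≥ 1} exp(-π n² x)` as a real number. -/
noncomputable def psiReal (x : ℝ) : ℝ := ∑' n : ℕ, Real.exp (-Real.pi * ((n : ℝ) + 1) ^ 2 * x)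

theorem thetaFn_eq_jacobiTheta (z : ℂ) : thetaFn z = jacobiTheta (Complex.I * z) := by
  refine tsum_congr fun n => congrArg Complex.exp ?_
  linear_combination (-(Real.pi : ℂ) * (n : ℂ) ^ 2 * z) * Complex.I_mul_I

theorem psiFn_ofReal {x : ℝ} (hx : 0 < x) : psiFn x = psiReal x := by
  have hsum := hasSum_nat_jacobiTheta (τ := Complex.I * x) (by simpa using hx)
  rw [psiFn, thetaFn_eq_jacobiTheta, ← hsum.tsum_eq, psiReal, Complex.ofReal_tsum]
  refine tsum_congr fun n => ?_
  push_cast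
  congr 1
  linear_combination ((Real.pi : ℂ) * ((n : ℂ) + 1) ^ 2 * x) * Complex.I_mul_I

theorem continuousOn_psiReal : ContinuousOn psiReal (Ioi 0) := by
  have hpsi : ContinuousOn (fun x : ℝ => (psiFn x).re) (Ioi 0) := fun x hx => by
    have htheta : ContinuousAt jacobiTheta (Complex.I * x) :=
      (differentiableAt_jacobiTheta (by simpa using hx)).continuousAt
    have hcomp : ContinuousAt (fun y : ℝ => jacobiTheta (Complex.I * y)) x :=
      ContinuousAt.comp (f := fun y : ℝ => Complex.I * y) htheta (by fun_prop)
    simp only [psiFn, thetaFn_eq_jacobiTheta]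
    exact (Complex.continuous_re.continuousAt.comp
      ((hcomp.sub continuousAt_const).div_const 2)).continuousWithinAt
  exact hpsi.congr fun x hx => (congrArg Complex.re (psiFn_ofReal hx)).symm

theorem exp_neg_pi_mul_sq_le {x : ℝ} (hx : 0 < x) (n : ℕ) :
    Real.exp (-Real.pi * ((n : ℝ) + 1) ^ 2 * x) ≤
      Real.exp (-Real.pi * x) * Real.exp (-(3 * Real.pi * x)) ^ n := by
  rw [← Real.exp_nat_mul, ← Real.exp_add, Real.exp_le_exp]
  have hn : (n : ℝ) ≤ (n : ℝ) ^ 2 := by exact_mod_cast Nat.le_self_pow two_ne_zero n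
  have hmul := mul_le_mul_of_nonneg_left hn (mul_pos Real.pi_pos hx).le
  linarith

theorem exp_neg_three_pi_mul_lt_one {x : ℝ} (hx : 0 < x) : Real.exp (-(3 * Real.pi * x)) < 1 :=
  Real.exp_lt_one_iff.mpr (neg_lt_zero.mpr (by positivity))

theorem summable_exp_neg_pi_mul_sq {x : ℝ} (hx : 0 < x) :
    Summable fun n : ℕ => Real.exp (-Real.pi * ((n : ℝ) + 1) ^ 2 * x) :=
  Summable.of_nonneg_of_le (fun _ => (Real.exp_pos _).le) (exp_neg_pi_mul_sq_le hx)
    ((summable_geometric_of_lt_one (Real.exp_pos _).le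
      (exp_neg_three_pi_mul_lt_one hx)).mul_left _)

theorem exp_neg_pi_mul_le_psiReal {x : ℝ} (hx : 0 < x) : Real.exp (-Real.pi * x) ≤ psiReal x := by
  simpa [psiReal] using (summable_exp_neg_pi_mul_sq hx).le_tsum 0 fun _ _ => (Real.exp_pos _).le

theorem psiReal_le {x : ℝ} (hx : 0 < x) :
    psiReal x ≤ (1 - Real.exp (-(3 * Real.pi * x)))⁻¹ * Real.exp (-Real.pi * x) := by
  rw [mul_comm]
  exact hasSum_le (exp_neg_pi_mul_sq_le hx) (summable_exp_neg_pi_mul_sq hx).hasSum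
    ((hasSum_geometric_of_lt_one (Real.exp_pos _).le (exp_neg_three_pi_mul_lt_one hx)).mul_left _)

theorem psiReal_le_of_one_le {x : ℝ} (hx : 1 ≤ x) :
    psiReal x ≤ 10000 / 9999 * Real.exp (-Real.pi * x) := by
  refine (psiReal_le (one_pos.trans_le hx)).trans ?_
  have hexp : Real.exp (-(3 * Real.pi * x)) ≤ 1 / 10000 :=
    calc Real.exp (-(3 * Real.pi * x)) ≤ Real.exp (-Real.pi) ^ 3 := by
          rw [← Real.exp_nat_mul, Real.exp_le_exp]
          push_cast
          nlinarith [Real.pi_pos]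
      _ ≤ 0.043215 ^ 3 := by
          gcongr
          exact exp_neg_pi_mem_Ioo.2.le
      _ ≤ 1 / 10000 := by norm_num
  gcongr
  rw [inv_le_comm₀ (by linarith) (by norm_num)]
  linarith

theorem isDecayingWeight_psiReal : IsDecayingWeight psiReal where
  continuousOn := continuousOn_psiReal.mono (Ici_subset_Ioi.mpr one_pos)
  pos x hx := (Real.exp_pos _).trans_le (exp_neg_pi_mul_le_psiReal (one_pos.trans_le hx))
  exists_isBigO := by
    refine ⟨Real.pi, Real.pi_pos, Asymptotics.IsBigO.of_bound (10000 / 9999) ?_⟩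
    filter_upwards [eventually_ge_atTop 1] with x hx
    have hpos := (Real.exp_pos _).trans_le (exp_neg_pi_mul_le_psiReal (one_pos.trans_le hx))
    rw [Real.norm_of_nonneg hpos.le, Real.norm_of_nonneg (Real.exp_pos _).le]
    exact psiReal_le_of_one_le hx

theorem exists_real_zero_lavrikF_psiReal :
    ∃ b : ℝ, (∀ x : ℝ, lavrikF psiReal x = 0 ↔ x = b) ∧ |b - 11.25| < 0.005 := by
  have hpsi := isDecayingWeight_psiReal
  have hexp := IsDecayingWeight.const_mul_exp Real.pi_pos
  have hlt : (11.245 : ℝ) * tailMoment psiReal (11.245 / 2) < 1 := by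
    have hle := hpsi.tailMoment_le_mul hexp (fun x hx => psiReal_le_of_one_le hx) 5.6225
    rw [show (11.245 / 2 : ℝ) = 5.6225 by norm_num]
    have hupper := incGamma_pi_at_left_le
    rw [incGamma] at hupper
    linarith
  have hgt : 1 < (11.255 : ℝ) * tailMoment psiReal (11.255 / 2) := by
    have hle := hexp.tailMoment_le_mul hpsi (C := 1) (fun x hx => by
      simpa using exp_neg_pi_mul_le_psiReal (one_pos.trans_le hx)) 5.6275
    rw [show (11.255 / 2 : ℝ) = 5.6275 by norm_num]
    have hlower := le_incGamma_pi_at_right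
    rw [incGamma] at hlower
    linarith
  obtain ⟨b, hb, hzero⟩ := hpsi.exists_real_zero_lavrikF (by norm_num) hlt hgt
  exact ⟨b, hzero, abs_lt.mpr ⟨by linarith [hb.1], by linarith [hb.2]⟩⟩

theorem cpow_mul_psiFn_div {x : ℝ} (hx : 0 < x) (s : ℂ) :
    (x : ℂ) ^ s * psiFn x / x = (x : ℂ) ^ (s - 1) * psiReal x := by
  rw [psiFn_ofReal hx, Complex.cpow_sub _ _ (Complex.ofReal_ne_zero.mpr hx.ne'), Complex.cpow_one]
  ring

theorem lavrikF_psiReal_eq_mul_lavrikLambda {s : ℂ} (hs : ∀ n : ℕ, s ≠ -2 * (n : ℂ)) :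
    lavrikF psiReal s = s * lavrikLambda s := by
  have h0 : s ≠ 0 := by simpa using hs 0
  have hint : ∫ x in Ioi (1 : ℝ), (x : ℂ) ^ (s / 2) * psiFn (1 * x) / x =
      tailMellin psiReal (s / 2) :=
    setIntegral_congr_fun measurableSet_Ioi fun x hx => by
      rw [one_mul, cpow_mul_psiFn_div (one_pos.trans hx)]
  rw [lavrikLambda, lavrikL_equation 1 s hs, hint, lavrikF, Complex.one_cpow, one_mul]
  field_simp

theorem tailMellin_psiReal_zero : tailMellin psiReal 0 = lavrikAlpha :=
  setIntegral_congr_fun measurableSet_Ioi fun x hx => by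
    simpa using (cpow_mul_psiFn_div (one_pos.trans hx) 0).symm

theorem integrableOn_psiFn_div : IntegrableOn (fun y : ℝ => psiFn y / y) (Ioi 1) := by
  have hint : IntegrableOn (fun x : ℝ => ((x ^ (-1 : ℝ) * psiReal x : ℝ) : ℂ)) (Ioi 1) :=
    (isDecayingWeight_psiReal.integrableOn_rpow_mul (-1)).ofReal
  refine hint.congr_fun (fun x hx => ?_) measurableSet_Ioi
  have hx0 : 0 < x := one_pos.trans hx
  simp [psiFn_ofReal hx0, Real.rpow_neg_one, div_eq_inv_mul]

end Psi

theorem theoremT :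
    ∃ F : ℂ → ℂ,
      -- `s π^{-s/2} Γ(s/2) 𝓛(s)` is an entire function `F`, of order `1`
      Differentiable ℂ F ∧
      (∀ s : ℂ, (∀ n : ℕ, s ≠ -2 * (n : ℂ)) → F s = s * lavrikLambda s) ∧
      entireOrder F = 1 ∧
      -- it has exactly one real zero, which is `≈ 11.25`
      (∃ b₀ : ℝ, (∀ x : ℝ, F (x : ℂ) = 0 ↔ x = b₀) ∧ |b₀ - 11.25| < 0.005) ∧
      -- it has infinitely many non-real zeros, and all zeros can be numbered as `(b_n)_{n ∈ ℤ}`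
      {z : ℂ | F z = 0 ∧ z.im ≠ 0}.Infinite ∧
      (∃ b : ℤ → ℂ, IsZeroNumbering F b) ∧
      -- the infinite product, for every such numbering
      IntegrableOn (fun y : ℝ => psiFn y / y) (Set.Ioi 1) ∧
      ∀ b : ℤ → ℂ, IsZeroNumbering F b → ∀ s : ℂ,
        Multipliable (fun n : ℤ => (1 - s / b n) * Complex.exp (s / b n)) ∧
        F s = -Complex.exp (-lavrikAlpha * s) *
          ∏' n : ℤ, (1 - s / b n) * Complex.exp (s / b n) ∧
        ((∀ n : ℕ, s ≠ -2 * (n : ℂ)) →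
          lavrikLambda s = -(Complex.exp (-lavrikAlpha * s) / s) *
            ∏' n : ℤ, (1 - s / b n) * Complex.exp (s / b n)) := by
  have hψ := isDecayingWeight_psiReal
  obtain ⟨b₀, hb₀, hnear⟩ := exists_real_zero_lavrikF_psiReal
  refine ⟨lavrikF psiReal, hψ.differentiable_lavrikF,
    fun _ => lavrikF_psiReal_eq_mul_lavrikLambda, hψ.entireOrder_lavrikF, ⟨b₀, hb₀, hnear⟩,
    hψ.infinite_nonreal_zeros_lavrikF, ?_, integrableOn_psiFn_div, fun b hb s => ?_⟩
  · exact exists_isZeroNumbering hψ.differentiable_lavrikF (lavrikF_zero_ne_zero _)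
      (lavrikF_conj _) hb₀ (hψ.analyticOrderAt_lavrikF_of_real_zero ((hb₀ b₀).mpr rfl))
      hψ.infinite_nonreal_zeros_lavrikF
  · have hprod := tailMellin_psiReal_zero ▸ hψ.lavrikF_eq_mul_tprod hb.multiplicity s
    refine ⟨hψ.multipliable_zeros_lavrikF hb.multiplicity s, hprod, fun hs => ?_⟩
    have hs0 : s ≠ 0 := by simpa using hs 0
    rw [neg_div', div_mul_eq_mul_div, eq_div_iff hs0, mul_comm, ← hprod,
      lavrikF_psiReal_eq_mul_lavrikLambda hs]
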